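/- Let $W,d\ge 1$ be integers and let $\mathbb{Z}_W=\mathbb{Z}\times\{1,\dots,W\}$. Let $V_i$, $i\in\mathbb{Z}_W$, be i.i.d. real random variables having a density $\rho$ with $0\le\rho(x)\le D_0<\infty$ for all $x$. Let $U_n$, $n\in\mathbb{Z}$, be random real symmetric $W\times W$ matrices such that $U_n(x,y)=0$ for $|x-y|>d$ and such that the family $(U_n)$ is independent of the family $(V_i)$. Assume that $$\mathbb{P}(|V_i|\ge T)\le D_1/T,\qquad \mathbb{P}(\|U_n\|\ge T)\le D_1/T\qquad\text{for all } T\ge 1,$$ where $\|\cdot\|$ is the Euclidean operator norm. Let $H$ be the operator $$(H\Psi)_n=-\Psi_{n-1}-\Psi_{n+1}+S_n\Psi_n,\qquad S_n=\operatorname{diag}(V_{(n,1)},\dots,V_{(n,W)})-U_n .$$ For a finite set $\Lambda\subset\mathbb{Z}_W$ let $H_\Lambda$ be the restriction of $H$ to $\Lambda$ with Dirichlet boundary conditions (the matrix $(\langle\delta_i,H\delta_j\rangle)_{i,j\in\Lambda}$), and for $E\in\mathbb{R}$ let $f_\Lambda^E=\det(H_\Lambda-E)$. There exist absolute constants $c>0$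 and $C_1>1$, and a constant $C_0=C_0(D_0,D_1,|E|,d)>0$ depending only on the indicated quantities, such that for every such model, every $E\in\mathbb{R}$ and every finite $\Lambda\subset\mathbb{Z}_W$ the random variable $\log|f_\Lambda^E|$ is square integrable and $$\operatorname{Var}(\log|f_\Lambda^E|)\ \ge\ c\,|\Lambda|\,|I|\,\inf_{x\in I}\rho(x)$$ for every interval $I$ of the form $[M_0,C_1M_0]$ or $[-C_1M_0,-M_0]$ with $M_0\ge C_0$, where $|I|$ denotes the length of $I$ and $|\Lambda|$ the number of elements of $\Lambda$. -/

import Mathlib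

open MeasureTheory ProbabilityTheory

noncomputable section

/-- The `W × W` matrix `S_n = diag(V_{(n,1)}, …, V_{(n,W)}) - U_n`.
The strip `ℤ × {1, …, W}` is modelled as `ℤ × Fin W`. -/
def stripS {W : ℕ} (V : ℤ × Fin W → ℝ) (U : ℤ → Matrix (Fin W) (Fin W) ℝ) (n : ℤ) :
    Matrix (Fin W) (Fin W) ℝ :=
  Matrix.diagonal (fun x => V (n, x)) - U n

/-- The operator `(HΨ)_n = -Ψ_{n-1} - Ψ_{n+1} + S_n Ψ_n` on functions on the strip
(for a fixed realization of the potentials `V` and of the matrices `U_n`). -/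
def stripH {W : ℕ} (V : ℤ × Fin W → ℝ) (U : ℤ → Matrix (Fin W) (Fin W) ℝ)
    (Ψ : ℤ → Fin W → ℝ) : ℤ → Fin W → ℝ :=
  fun n => -Ψ (n - 1) - Ψ (n + 1) + (stripS V U n).mulVec (Ψ n)

/-- The function on the strip equal to `1` at the site `j` and to `0` elsewhere. -/
def stripDelta {W : ℕ} (j : ℤ × Fin W) : ℤ → Fin W → ℝ :=
  Pi.single j.1 (Pi.single j.2 1)

/-- The restriction `H_Λ` of `H` to a finite set `Λ` with Dirichlet boundary conditions, as a matrix
indexed by the sites of `Λ`: its `(i, j)` entry is `(H δ_j)(i)`. -/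
def stripHRestr {W : ℕ} (V : ℤ × Fin W → ℝ) (U : ℤ → Matrix (Fin W) (Fin W) ℝ)
    (Λ : Finset (ℤ × Fin W)) : Matrix Λ Λ ℝ :=
  Matrix.of fun i j => stripH V U (stripDelta j.1) i.1.1 i.1.2

/-- The Dirichlet determinant `f_Λ^E = det (H_Λ - E)`. -/
def dirichletDet {W : ℕ} (V : ℤ × Fin W → ℝ) (U : ℤ → Matrix (Fin W) (Fin W) ℝ)
    (Λ : Finset (ℤ × Fin W)) (E : ℝ) : ℝ :=
  (stripHRestr V U Λ - E • (1 : Matrix Λ Λ ℝ)).det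

/-- The matrix entries of `H_Λ`. -/
theorem stripHRestr_apply {W : ℕ} (V : ℤ × Fin W → ℝ) (U : ℤ → Matrix (Fin W) (Fin W) ℝ)
    (Λ : Finset (ℤ × Fin W)) (i j : Λ) :
    stripHRestr V U Λ i j =
      if i.1.1 = j.1.1 then (if i.1.2 = j.1.2 then V i.1 else 0) - U i.1.1 i.1.2 j.1.2
      else if |i.1.1 - j.1.1| = 1 ∧ i.1.2 = j.1.2 then -1 else 0 := by
  obtain ⟨⟨n, x⟩, hi⟩ := i
  obtain ⟨⟨m, y⟩, hj⟩ := j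
  simp only [stripHRestr, Matrix.of_apply, stripH, stripDelta, Pi.add_apply, Pi.sub_apply,
    Pi.neg_apply, Pi.single_apply]
  by_cases h : n = m
  · subst h
    simp [stripS, Matrix.diagonal_apply]
  · by_cases h1 : n - 1 = m
    · have h2 : ¬ n + 1 = m := by omega
      have h3 : |n - m| = 1 := by rw [← h1]; norm_num
      by_cases hx : x = y <;> simp [h, h1, h2, h3, hx]
    · by_cases h2 : n + 1 = m
      · have h3 : |n - m| = 1 := by rw [← h2]; norm_num
        by_cases hx : x = y <;> simp [h, h1, h2, h3, hx]
      · have h3 : ¬ |n - m| = 1 := by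
          rw [abs_eq one_pos.le]; omega
        simp [h, h1, h2, h3]

/-- The standing assumptions on the random strip operator: the potentials `V_i` are i.i.d. real random
variables with density `ρ` bounded by `D₀`; the `U_n` are random real symmetric matrices with
band width `d`, and the family `(U_n)` is independent of the family `(V_i)`; and
`ℙ(|V_i| ≥ T) ≤ D₁ / T`, `ℙ(‖U_n‖ ≥ T) ≤ D₁ / T` for `T ≥ 1`, where `‖U_n‖` is the operator norm
on Euclidean space. No independence or identical distribution of the `U_n` is imposed. -/
structure IsRandomStrip {Ω : Type*} [MeasurableSpace Ω] (P : Measure Ω) {W : ℕ}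
    (V : ℤ × Fin W → Ω → ℝ) (U : ℤ → Ω → Matrix (Fin W) (Fin W) ℝ)
    (ρ : ℝ → ℝ) (D₀ D₁ : ℝ) (d : ℕ) : Prop where
  measurable_V : ∀ i, Measurable (V i)
  measurable_U : ∀ n x y, Measurable fun ω => U n ω x y
  measurable_density : Measurable ρ
  density_nonneg : ∀ t, 0 ≤ ρ t
  density_le : ∀ t, ρ t ≤ D₀
  law_V : ∀ i, P.map (V i) = volume.withDensity fun t => ENNReal.ofReal (ρ t)
  indep_V : iIndepFun V P
  indep_V_U : IndepFun (fun ω i => V i ω)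
    (fun ω (k : ℤ × Fin W × Fin W) => U k.1 ω k.2.1 k.2.2) P
  symm_U : ∀ n ω, (U n ω).IsSymm
  band_U : ∀ n ω (x y : Fin W), (d : ℤ) < |(x : ℤ) - (y : ℤ)| → U n ω x y = 0
  tail_V : ∀ i (T : ℝ), 1 ≤ T → P.real {ω | T ≤ |V i ω|} ≤ D₁ / T
  tail_U : ∀ n (T : ℝ), 1 ≤ T →
    P.real {ω | T ≤ ‖Matrix.toEuclideanCLM (𝕜 := ℝ) (U n ω)‖} ≤ D₁ / T

end

/-! Fix a site `i` of Λ. Expanding along `i` gives f_Λ = f_{Λ∖i} · (V_i − ξ_i), where the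
self-energy ξ_i is a quadratic form in the resolvent on Λ∖i, so that neither f_{Λ∖i} nor ξ_i
involves V_i (`det_principal_insert`, `selfEnergy_update`). Every site therefore contributes its own
fluctuation log|V_i − ξ_i|, provided ξ_i is not too large.

To detect it, let m be the infimum of ρ on I and test against φ(V_i) with φ = m·h/ρ, where h is +1
on the upper half of I and −1 on the lower half. Then |φ| ≤ 1 and φ(V_i) has mean zero, so the
summand log|f_{Λ∖i}| drops out and Cov(log|f_Λ|, φ(V_i)) = m · 𝔼 ∫ h(t) log|t − ξ_i| dt. With I =
[M, 3M], this logarithmic potential is at least M/4 for |ξ_i| < εM and never below −CM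
(`exists_isLogTest`), so the covariance is at least of order mM once |ξ_i| ≥ εM has small
probability. As the φ(V_i) are independent with variance at most m|I|, a Bessel inequality adds the
contributions of all sites (`le_variance_of_le_covariance`).

What remains is tightness of ξ_i, uniform in Λ and in the width W. Entries of the resolvent satisfy
a weak L¹ bound with constant 8D₀, from the bounded density alone (`measure_le_abs_inv_principal`).
The band structure lets at most 2d+3 sites enter ξ_i, whence `measure_le_abs_selfEnergy`. The same
tail bounds make every logarithm square integrable. -/

noncomputable section

/-! ### Schur complements and resolvent entries -/

section SchurComplement

variable {ι : Type*} [DecidableEq ι]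

/-- The principal submatrix of `A` on the finite set `S`. -/
def principal (A : Matrix ι ι ℝ) (S : Finset ι) : Matrix S S ℝ :=
  A.submatrix (fun i => i.1) (fun i => i.1)

/-- The entry `(p, q)` of the Schur complement of the principal submatrix of `A` on `S`. -/
def schur (A : Matrix ι ι ℝ) (S : Finset ι) (p q : ι) : ℝ :=
  A p q - ∑ m : S, ∑ l : S, A p m * (principal A S)⁻¹ m l * A l q

/-- Isolates the diagonal entry at `i`: the first factor does not contain it, and the second is
affine in it with slope 1. -/
theorem det_principal_insert (A : Matrix ι ι ℝ) {S : Finset ι} {i : ι} (hi : i ∉ S)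
    (hS : (principal A S).det ≠ 0) :
    (principal A (insert i S)).det = (principal A S).det * schur A S i i := by
  have := Matrix.invertibleOfIsUnitDet (principal A S) (isUnit_iff_ne_zero.mpr hS)
  let e : S ⊕ Unit ≃ (insert i S : Finset ι) :=
    (Equiv.optionEquivSumPUnit S).symm.trans (Finset.subtypeInsertEquivOption hi).symm
  have hl (m : S) : (e (Sum.inl m)).1 = m.1 := rfl
  have hr : (e (Sum.inr ())).1 = i := rfl
  rw [← Matrix.det_submatrix_equiv_self e]
  have hA : (principal A (insert i S)).submatrix e e =
      Matrix.fromBlocks (principal A S) (Matrix.of fun m _ => A m i) (Matrix.of fun _ m => A i m)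
        (Matrix.of fun _ _ => A i i) := by
    ext (a | a) (b | b) <;> simp [principal, hl, hr]
  rw [hA, Matrix.det_fromBlocks₁₁, Matrix.det_unique (n := Unit)]
  congr 1
  simp only [Matrix.sub_apply, Matrix.of_apply, Matrix.mul_apply, schur, Matrix.invOf_eq_nonsing_inv,
    Finset.sum_mul]
  rw [Finset.sum_comm]

/-- Eliminating the unknowns in `S` from a linear system on `S ∪ T` leaves the system of the Schur
complement on `T`. -/
theorem sum_schur_mul (A : Matrix ι ι ℝ) {S T : Finset ι} (hS : (principal A S).det ≠ 0) (x : ι → ℝ)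
    (h0 : ∀ l ∈ S, ∑ m ∈ S, A l m * x m + ∑ q ∈ T, A l q * x q = 0) (p : ι) :
    ∑ q ∈ T, schur A S p q * x q = ∑ m ∈ S, A p m * x m + ∑ q ∈ T, A p q * x q := by
  have hx (m : S) : x m = - ∑ l : S, (principal A S)⁻¹ m l * ∑ q ∈ T, A l q * x q := by
    have h1 : (principal A S).mulVec (fun m : S => x m) = fun l : S => - ∑ q ∈ T, A l q * x q := by
      ext l
      have := h0 l l.2
      rw [← Finset.sum_coe_sort] at this
      simp only [Matrix.mulVec, dotProduct, principal, Matrix.submatrix_apply]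
      linarith
    have h2 : (fun m : S => x m) = (principal A S)⁻¹.mulVec fun l : S => - ∑ q ∈ T, A l q * x q := by
      rw [← h1, Matrix.mulVec_mulVec, Matrix.nonsing_inv_mul _ (isUnit_iff_ne_zero.mpr hS),
        Matrix.one_mulVec]
    have := congrFun h2 m
    simpa [Matrix.mulVec, dotProduct] using this
  simp only [schur, sub_mul, Finset.sum_sub_distrib]
  rw [← Finset.sum_coe_sort S (fun m => A p m * x m)]
  have : ∑ q ∈ T, (∑ m : S, ∑ l : S, A p m * (principal A S)⁻¹ m l * A l q) * x q
      = - ∑ m : S, A p m * x m := by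
    rw [← Finset.sum_neg_distrib]
    simp only [Finset.sum_mul]
    rw [Finset.sum_comm]
    refine Finset.sum_congr rfl fun m _ => ?_
    rw [hx m, Finset.sum_comm, mul_neg, neg_neg, Finset.mul_sum]
    refine Finset.sum_congr rfl fun l _ => ?_
    rw [Finset.mul_sum, Finset.mul_sum]
    exact Finset.sum_congr rfl fun q _ => by ring
  rw [this]
  ring

/-- A column of the inverse of a principal submatrix, as a system of equations. -/
theorem sum_mul_inv_principal (A : Matrix ι ι ℝ) {S : Finset ι} (hS : (principal A S).det ≠ 0)
    (p k : S) :
    ∑ m : S, A p m * (principal A S)⁻¹ m k = if p = k then 1 else 0 := by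
  have := congrFun (congrFun (Matrix.mul_nonsing_inv (principal A S)
    (isUnit_iff_ne_zero.mpr hS)) p) k
  simpa [Matrix.mul_apply, principal, Matrix.one_apply] using this

/-- Column `k` of the inverse solves A x = δ_k on `S`. Since `k ∈ T`, the right-hand side vanishes
on `S \ T`, so those unknowns can be eliminated. It is used with `T` of one or two sites, to express
resolvent entries through a 1×1 or 2×2 Schur complement. -/
theorem sum_schur_mul_inv_principal (A : Matrix ι ι ℝ) {S T : Finset ι} (hTS : T ⊆ S)
    (h0 : (principal A (S \ T)).det ≠ 0) (h : (principal A S).det ≠ 0) {k : ι} (hkT : k ∈ T)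
    (hk : k ∈ S) (x : ι → ℝ) (hx : ∀ m (hm : m ∈ S), x m = (principal A S)⁻¹ ⟨m, hm⟩ ⟨k, hk⟩)
    {p : ι} (hp : p ∈ S) :
    ∑ q ∈ T, schur A (S \ T) p q * x q = if p = k then 1 else 0 := by
  have hx' (p : ι) (hp : p ∈ S) :
      ∑ m ∈ S \ T, A p m * x m + ∑ q ∈ T, A p q * x q = if p = k then 1 else 0 := by
    rw [Finset.sum_sdiff hTS, ← Finset.sum_coe_sort]
    have := sum_mul_inv_principal A h ⟨p, hp⟩ ⟨k, hk⟩
    simp only [Subtype.mk.injEq] at this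
    rw [← this]
    exact Finset.sum_congr rfl fun m _ => by rw [hx m.1 m.2]
  rw [sum_schur_mul A h0 x, hx' p hp]
  intro l hl
  rw [Finset.mem_sdiff] at hl
  rw [hx' l hl.1, if_neg]
  rintro rfl
  exact hl.2 hkT

theorem inv_principal_isSymm {A : Matrix ι ι ℝ} (hA : A.IsSymm) (S : Finset ι) :
    ((principal A S)⁻¹).IsSymm := by
  rw [Matrix.IsSymm, Matrix.transpose_nonsing_inv, principal, Matrix.transpose_submatrix, hA.eq]

theorem schur_comm {A : Matrix ι ι ℝ} (hA : A.IsSymm) (S : Finset ι) (p q : ι) :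
    schur A S p q = schur A S q p := by
  rw [schur, schur, hA.apply, Finset.sum_comm]
  congr 1
  refine Finset.sum_congr rfl fun l _ => Finset.sum_congr rfl fun m _ => ?_
  rw [(inv_principal_isSymm hA S).apply, hA.apply p, hA.apply _ q]
  ring

theorem schur_mul_inv_principal_diag (A : Matrix ι ι ℝ) {S : Finset ι} {k : ι} (hk : k ∈ S)
    (h0 : (principal A (S \ {k})).det ≠ 0) (h : (principal A S).det ≠ 0) :
    schur A (S \ {k}) k k * (principal A S)⁻¹ ⟨k, hk⟩ ⟨k, hk⟩ = 1 := by
  have := sum_schur_mul_inv_principal A (Finset.singleton_subset_iff.mpr hk) h0 h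
    (Finset.mem_singleton_self k) hk
    (fun m => if hm : m ∈ S then (principal A S)⁻¹ ⟨m, hm⟩ ⟨k, hk⟩ else 0)
    (fun m hm => dif_pos hm) hk
  simpa [hk] using this

theorem schur_mul_inv_principal_offDiag {A : Matrix ι ι ℝ} (hA : A.IsSymm) {S : Finset ι}
    {j k : ι} (hjk : j ≠ k) (hj : j ∈ S) (hk : k ∈ S)
    (h0 : (principal A (S \ {j, k})).det ≠ 0) (h : (principal A S).det ≠ 0) :
    schur A (S \ {j, k}) j j * (principal A S)⁻¹ ⟨j, hj⟩ ⟨k, hk⟩ +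
        schur A (S \ {j, k}) j k * (principal A S)⁻¹ ⟨k, hk⟩ ⟨k, hk⟩ = 0 ∧
      schur A (S \ {j, k}) j k * (principal A S)⁻¹ ⟨j, hj⟩ ⟨k, hk⟩ +
        schur A (S \ {j, k}) k k * (principal A S)⁻¹ ⟨k, hk⟩ ⟨k, hk⟩ = 1 := by
  have hTS : ({j, k} : Finset ι) ⊆ S := by
    intro m; simp only [Finset.mem_insert, Finset.mem_singleton]; rintro (rfl | rfl) <;> assumption
  have key (p : ι) (hp : p ∈ S) := sum_schur_mul_inv_principal A hTS h0 h (k := k) (by simp) hk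
    (fun m => if hm : m ∈ S then (principal A S)⁻¹ ⟨m, hm⟩ ⟨k, hk⟩ else 0)
    (fun m hm => dif_pos hm) hp
  have h1 := key j hj
  have h2 := key k hk
  rw [Finset.sum_pair hjk] at h1 h2
  rw [schur_comm hA _ k j] at h2
  simp only [dif_pos hj, dif_pos hk, if_neg hjk, if_true] at h1 h2
  exact ⟨h1, h2⟩

theorem principal_diagonal_update_add (B : Matrix ι ι ℝ) (v : ι → ℝ) {S : Finset ι} {i : ι}
    (hi : i ∉ S) (t : ℝ) :
    principal (Matrix.diagonal (Function.update v i t) + B) S =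
      principal (Matrix.diagonal v + B) S := by
  ext a b
  have ha : a.1 ≠ i := fun h => hi (h ▸ a.2)
  simp [principal, Matrix.diagonal_apply, ha]

/-- For `i ∉ S`, only the corner entry `(i, i)` of the Schur complement sees `v i`; all the others
are constants when `v i` alone is resampled. -/
theorem schur_diagonal_update_add_of_ne (B : Matrix ι ι ℝ) (v : ι → ℝ) {S : Finset ι} {i : ι}
    (hi : i ∉ S) (t : ℝ) {p q : ι} (hpq : p ≠ i ∨ q ≠ i) :
    schur (Matrix.diagonal (Function.update v i t) + B) S p q =
      schur (Matrix.diagonal v + B) S p q := by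
  have hm (m : S) : m.1 ≠ i := fun h => hi (h ▸ m.2)
  have h (p q : ι) (hpq : p ≠ i ∨ q ≠ i) :
      Matrix.diagonal (Function.update v i t) p q = Matrix.diagonal v p q := by
    rcases eq_or_ne p q with rfl | hne
    · have : p ≠ i := by tauto
      simp [this]
    · simp [hne]
  simp only [schur, principal_diagonal_update_add B v hi t, Matrix.add_apply, h p q hpq]
  congr 1
  refine Finset.sum_congr rfl fun m _ => Finset.sum_congr rfl fun l _ => ?_
  rw [h p m (Or.inr (hm m)), h l q (Or.inl (hm l))]

/-- The diagonal entry of the Schur complement at `i` is `v i - selfEnergy B S i v`. -/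
def selfEnergy (B : Matrix ι ι ℝ) (S : Finset ι) (i : ι) (v : ι → ℝ) : ℝ :=
  v i - schur (Matrix.diagonal v + B) S i i

theorem selfEnergy_eq (B : Matrix ι ι ℝ) {S : Finset ι} {i : ι} (hi : i ∉ S) (v : ι → ℝ) :
    selfEnergy B S i v = - B i i +
      ∑ m : S, ∑ l : S, B i m * (principal (Matrix.diagonal v + B) S)⁻¹ m l * B l i := by
  have hm (m : S) : i ≠ m.1 := fun h => hi (h ▸ m.2)
  have hm' (m : S) : m.1 ≠ i := fun h => hi (h ▸ m.2)
  simp [selfEnergy, schur, hm, hm']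
  ring

theorem selfEnergy_update (B : Matrix ι ι ℝ) {S : Finset ι} {i : ι} (hi : i ∉ S) (v : ι → ℝ)
    (t : ℝ) : selfEnergy B S i (Function.update v i t) = selfEnergy B S i v := by
  simp only [selfEnergy_eq B hi, principal_diagonal_update_add B v hi t]

/-- If an off-diagonal entry of the inverse is large, then one of two diagonal variables lies close
to a value that does not depend on it. -/
theorem abs_sub_le_of_le_abs_offDiag {x y c g k T : ℝ} (hT : 0 < T) (h1 : x * g + c * k = 0)
    (h2 : c * g + y * k = 1) (hg : T ≤ |g|) :
    |x - c ^ 2 / y| ≤ T⁻¹ ∨ |y - c ^ 2 / x| ≤ T⁻¹ ∨ |x - (|c|)| ≤ T⁻¹ ∨ |x - (-|c|)| ≤ T⁻¹ := by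
  -- Cramer's rule: a large `g` forces the determinant `x * y - c ^ 2` to be small compared with
  -- `c`.
  have key : (x * y - c ^ 2) * g = -c := by linear_combination y * h1 - c * h2
  have hkey : |x * y - c ^ 2| * T ≤ |c| := by
    calc _ ≤ |x * y - c ^ 2| * |g| := by gcongr
      _ = |c| := by rw [← abs_mul, key, abs_neg]
  have aux (x y : ℝ) (hy : y ≠ 0) (hcy : |c| ≤ |y|) (hk : |x * y - c ^ 2| * T ≤ |c|) :
      |x - c ^ 2 / y| ≤ T⁻¹ := by
    have : x - c ^ 2 / y = (x * y - c ^ 2) / y := by field_simp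
    rw [this, abs_div, div_le_iff₀ (abs_pos.mpr hy), ← mul_le_mul_iff_left₀ hT]
    calc _ ≤ |y| := hk.trans hcy
      _ = _ := by field_simp
  by_cases hy : |c| ≤ |y|
  · refine Or.inl (aux x y ?_ hy hkey)
    rintro rfl
    have : c = 0 := by simpa using hy
    simp [this] at h2
  by_cases hx : |c| ≤ |x|
  · refine Or.inr (Or.inl (aux y x ?_ hx (by rwa [mul_comm y x])))
    rintro rfl
    have : c = 0 := by simpa using hx
    subst this
    simp at hy
  -- With both diagonal entries below `|c|`, the determinant is at least |c|(|c| − |x|) in absolute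
  -- value, so `x` lies close to one of ±|c|.
  push Not at hx hy
  have hc : 0 < |c| := (abs_nonneg x).trans_lt hx
  have h3 : (|c| - |x|) ≤ T⁻¹ := by
    rw [← mul_le_mul_iff_left₀ hT, inv_mul_cancel₀ hT.ne', ← mul_le_mul_iff_right₀ hc, mul_one]
    refine le_trans ?_ hkey
    rw [← mul_assoc]
    gcongr
    have : |x * y| ≤ |x| * |c| := by rw [abs_mul]; gcongr
    have h4 : c ^ 2 = |c| * |c| := by rw [← sq, sq_abs]
    have := neg_abs_le (x * y - c ^ 2)
    have := le_abs_self (x * y)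
    nlinarith
  refine Or.inr (Or.inr ?_)
  rcases abs_cases x with ⟨hx', _⟩ | ⟨hx', _⟩
  · left; rw [abs_le]; constructor <;> [linarith; linarith [inv_pos.mpr hT]]
  · right; rw [abs_le]; constructor <;> [linarith [inv_pos.mpr hT]; linarith]

end SchurComplement

/-! ### Square integrability of logarithms -/

/-- A function whose distribution has a tail of order `1 / T` has a square integrable logarithm. -/
theorem memLp_log_one_add_abs {Ω : Type*} [MeasurableSpace Ω] {P : Measure Ω}
    [IsProbabilityMeasure P] {Y : Ω → ℝ} (hY : Measurable Y) {C : ℝ}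
    (hC : ∀ T, 1 ≤ T → P.real {ω | T ≤ |Y ω|} ≤ C / T) :
    MemLp (fun ω => Real.log (1 + |Y ω|)) 2 P := by
  have hC0 : 0 ≤ C := by simpa using measureReal_nonneg.trans (hC 1 le_rfl)
  -- Layer cake: with a tail of order 1/t any moment of order below 1 is finite. The order 1/2
  -- suffices, because log² (1 + |Y|) ≤ 16 (1 + |Y|)^(1/2).
  have hfin : ∫⁻ ω, ENNReal.ofReal (|Y ω| ^ (1 / 2 : ℝ)) ∂P < ⊤ := by
    rw [lintegral_rpow_eq_lintegral_meas_le_mul P (Filter.Eventually.of_forall fun ω => abs_nonneg _)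
      hY.abs.aemeasurable (by norm_num)]
    refine ENNReal.mul_lt_top ENNReal.ofReal_lt_top ?_
    rw [← Set.Ioc_union_Ioi_eq_Ioi (zero_le_one' ℝ)]
    refine (lintegral_union_le _ _ _).trans_lt (ENNReal.add_lt_top.mpr ⟨?_, ?_⟩)
    · have h1 : IntegrableOn (fun t : ℝ => t ^ (1 / 2 - 1 : ℝ)) (Set.Ioc 0 1) := by
        rw [← intervalIntegrable_iff_integrableOn_Ioc_of_le zero_le_one]
        exact intervalIntegral.intervalIntegrable_rpow' (by norm_num)
      refine lt_of_le_of_lt (lintegral_mono fun t => ?_) h1.lintegral_lt_top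
      exact (mul_le_mul_left prob_le_one _).trans (one_mul _).le
    · have h1 : IntegrableOn (fun t : ℝ => C * t ^ (-3 / 2 : ℝ)) (Set.Ioi 1) :=
        (integrableOn_Ioi_rpow_of_lt (by norm_num) one_pos).const_mul C
      refine lt_of_le_of_lt (setLIntegral_mono' measurableSet_Ioi fun t ht => ?_)
        h1.lintegral_lt_top
      have ht' : (1 : ℝ) < t := ht
      have ht0 : 0 < t := one_pos.trans ht'
      rw [← ofReal_measureReal (by finiteness), ← ENNReal.ofReal_mul measureReal_nonneg]
      refine ENNReal.ofReal_le_ofReal ?_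
      calc _ ≤ C / t * t ^ (1 / 2 - 1 : ℝ) := by gcongr; exact hC t ht'.le
        _ = C * (t ^ (-1 : ℝ) * t ^ (1 / 2 - 1 : ℝ)) := by rw [Real.rpow_neg_one]; ring
        _ = _ := by rw [← Real.rpow_add ht0]; norm_num
  have hint : Integrable (fun ω => |Y ω| ^ (1 / 2 : ℝ)) P := by
    refine ⟨(hY.abs.pow_const _).aestronglyMeasurable, ?_⟩
    rwa [hasFiniteIntegral_iff_ofReal (Filter.Eventually.of_forall fun ω => by positivity)]
  have hm : AEMeasurable (fun ω => Real.log (1 + |Y ω|)) P := by fun_prop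
  rw [memLp_two_iff_integrable_sq hm.aestronglyMeasurable]
  refine (((integrable_const (1 : ℝ)).add hint).const_mul 16).mono'
    (hm.pow_const 2).aestronglyMeasurable
    (Filter.Eventually.of_forall fun ω => ?_)
  have h0 : 0 ≤ |Y ω| := abs_nonneg _
  rw [Real.norm_eq_abs, abs_of_nonneg (sq_nonneg _)]
  have h1 : Real.log (1 + |Y ω|) ≤ (1 + |Y ω|) ^ (1 / 4 : ℝ) / (1 / 4) :=
    Real.log_le_rpow_div (by positivity) (by norm_num)
  have h2 : 0 ≤ Real.log (1 + |Y ω|) := Real.log_nonneg (by linarith)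
  calc Real.log (1 + |Y ω|) ^ 2 ≤ ((1 + |Y ω|) ^ (1 / 4 : ℝ) / (1 / 4)) ^ 2 := by gcongr
    _ = 16 * ((1 + |Y ω|) ^ (1 / 4 : ℝ)) ^ 2 := by ring
    _ = 16 * (1 + |Y ω|) ^ (1 / 2 : ℝ) := by
      rw [← Real.rpow_natCast, ← Real.rpow_mul (by positivity)]; norm_num
    _ ≤ 16 * (1 ^ (1 / 2 : ℝ) + |Y ω| ^ (1 / 2 : ℝ)) := by
      gcongr
      exact Real.rpow_add_le_add_rpow zero_le_one h0 (by norm_num) (by norm_num)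
    _ = _ := by simp

/-- Treats the singularity at zero as growth of `y⁻¹`, so that one notion of tail covers both ends.
At `y = 0` the conventions for `Real.log` and the inverse make both sides zero. -/
theorem abs_log_abs_le (y : ℝ) :
    |Real.log (|y|)| ≤ Real.log (1 + |y|) + Real.log (1 + |y⁻¹|) := by
  rcases eq_or_ne y 0 with rfl | hy
  · simp
  have hy0 : 0 < |y| := abs_pos.mpr hy
  have h1 : Real.log |y| ≤ Real.log (1 + |y|) := Real.log_le_log hy0 (by linarith)
  have h2 : -Real.log |y| ≤ Real.log (1 + |y⁻¹|) := by
    rw [← Real.log_inv, abs_inv]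
    exact Real.log_le_log (by positivity) (by linarith)
  have h3 : 0 ≤ Real.log (1 + |y|) := Real.log_nonneg (by linarith)
  have h4 : 0 ≤ Real.log (1 + |y⁻¹|) := Real.log_nonneg (by linarith [abs_nonneg y⁻¹])
  rw [abs_le]
  constructor <;> linarith

/-- The product (1 + |x|)(1 + |y|) dominates 1 + |x + y|, and likewise 1 + |xy|. Hence
log-square-integrability passes to polynomial expressions, with no independence required. -/
theorem log_one_add_abs_add_le (x y : ℝ) :
    Real.log (1 + |x + y|) ≤ Real.log (1 + |x|) + Real.log (1 + |y|) := by
  rw [← Real.log_mul (by positivity) (by positivity)]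
  refine Real.log_le_log (by positivity) ?_
  nlinarith [abs_add_le x y, mul_nonneg (abs_nonneg x) (abs_nonneg y)]

theorem log_one_add_abs_mul_le (x y : ℝ) :
    Real.log (1 + |x * y|) ≤ Real.log (1 + |x|) + Real.log (1 + |y|) := by
  rw [← Real.log_mul (by positivity) (by positivity), abs_mul]
  refine Real.log_le_log (by positivity) ?_
  nlinarith [abs_nonneg x, abs_nonneg y]

/-- The functions `Y` for which `log (1 + |Y|)` is square integrable. -/
def LogSqIntegrable {Ω : Type*} [MeasurableSpace Ω] (P : Measure Ω) (Y : Ω → ℝ) : Prop :=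
  AEMeasurable Y P ∧ MemLp (fun ω => Real.log (1 + |Y ω|)) 2 P

namespace LogSqIntegrable

variable {Ω : Type*} [MeasurableSpace Ω] {P : Measure Ω} {X Y : Ω → ℝ}

theorem of_le {Z : Ω → ℝ} (hX : LogSqIntegrable P X) (hY : LogSqIntegrable P Y)
    (hZ : AEMeasurable Z P)
    (h : ∀ ω, Real.log (1 + |Z ω|) ≤ Real.log (1 + |X ω|) + Real.log (1 + |Y ω|)) :
    LogSqIntegrable P Z := by
  refine ⟨hZ, (hX.2.add hY.2).mono
    (by fun_prop : AEMeasurable _ P).aestronglyMeasurable (Filter.Eventually.of_forall fun ω => ?_)⟩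
  have h1 : 0 ≤ Real.log (1 + |Z ω|) := Real.log_nonneg (by linarith [abs_nonneg (Z ω)])
  rw [Real.norm_eq_abs, abs_of_nonneg h1]
  exact (h ω).trans (le_abs_self _)

theorem add (hX : LogSqIntegrable P X) (hY : LogSqIntegrable P Y) :
    LogSqIntegrable P (fun ω => X ω + Y ω) :=
  hX.of_le hY (hX.1.add hY.1) fun _ => log_one_add_abs_add_le _ _

theorem mul (hX : LogSqIntegrable P X) (hY : LogSqIntegrable P Y) :
    LogSqIntegrable P (fun ω => X ω * Y ω) :=
  hX.of_le hY (hX.1.mul hY.1) fun _ => log_one_add_abs_mul_le _ _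

theorem neg (hX : LogSqIntegrable P X) : LogSqIntegrable P (fun ω => -X ω) :=
  ⟨hX.1.neg, by simpa using hX.2⟩

theorem const [IsFiniteMeasure P] (c : ℝ) : LogSqIntegrable P (fun _ => c) :=
  ⟨by fun_prop, memLp_const _⟩

theorem sum {κ : Type*} [IsFiniteMeasure P] (s : Finset κ) {X : κ → Ω → ℝ}
    (hX : ∀ k ∈ s, LogSqIntegrable P (X k)) : LogSqIntegrable P (fun ω => ∑ k ∈ s, X k ω) := by
  classical
  induction s using Finset.induction_on with
  | empty => simpa using const 0
  | insert k s hk ih =>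
    simp only [Finset.sum_insert hk]
    exact (hX k (Finset.mem_insert_self _ _)).add
      (ih fun l hl => hX l (Finset.mem_insert_of_mem hl))

theorem memLp_log_abs (hX : LogSqIntegrable P X) (hX' : LogSqIntegrable P fun ω => (X ω)⁻¹) :
    MemLp (fun ω => Real.log |X ω|) 2 P := by
  have := hX.1
  refine (hX.2.add hX'.2).mono
    (by fun_prop : AEMeasurable _ P).aestronglyMeasurable (Filter.Eventually.of_forall fun ω => ?_)
  rw [Real.norm_eq_abs]
  exact (abs_log_abs_le _).trans (le_abs_self _)

theorem of_tail [IsProbabilityMeasure P] (hY : Measurable Y) {C : ℝ}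
    (hC : ∀ T, 1 ≤ T → P.real {ω | T ≤ |Y ω|} ≤ C / T) : LogSqIntegrable P Y :=
  ⟨hY.aemeasurable, memLp_log_one_add_abs hY hC⟩

end LogSqIntegrable

/-! ### Independent diagonal disorder: conditioning on all variables but one -/

/-- Real random variables `V i`, independent with common density `ρ` bounded by `D₀`, together with
a random variable `Z` that is independent of the whole family. -/
structure IsDiagonalDisorder {Ω ι 𝒵 : Type*} [MeasurableSpace Ω] [MeasurableSpace 𝒵]
    (P : Measure Ω) (V : ι → Ω → ℝ) (Z : Ω → 𝒵) (ρ : ℝ → ℝ) (D₀ : ℝ) : Prop where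
  measurable_V : ∀ i, Measurable (V i)
  measurable_Z : Measurable Z
  measurable_density : Measurable ρ
  density_nonneg : ∀ t, 0 ≤ ρ t
  density_le : ∀ t, ρ t ≤ D₀
  law_V : ∀ i, P.map (V i) = volume.withDensity fun t => ENNReal.ofReal (ρ t)
  indep_V : iIndepFun V P
  indep_V_Z : IndepFun (fun ω i => V i ω) Z P

namespace IsDiagonalDisorder

variable {Ω ι 𝒵 : Type*} [MeasurableSpace Ω] [MeasurableSpace 𝒵]
  {P : Measure Ω} {V : ι → Ω → ℝ} {Z : Ω → 𝒵} {ρ : ℝ → ℝ} {D₀ : ℝ}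

theorem measurable_pi (h : IsDiagonalDisorder P V Z ρ D₀) : Measurable fun ω i => V i ω :=
  measurable_pi_iff.mpr h.measurable_V

theorem measurable_pair (h : IsDiagonalDisorder P V Z ρ D₀) :
    Measurable fun ω => ((fun i => V i ω), Z ω) :=
  h.measurable_pi.prodMk h.measurable_Z

variable [DecidableEq ι] [IsProbabilityMeasure P]

/-- Each variable is independent of all the other ones and of `Z`, jointly. -/
theorem indepFun_update (h : IsDiagonalDisorder P V Z ρ D₀) (i : ι) :
    IndepFun (V i) (fun ω => (Function.update (fun j => V j ω) i 0, Z ω)) P := by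
  set V' : Ω → ι → ℝ := fun ω => Function.update (fun j => V j ω) i 0 with hV'
  have hm' : Measurable V' := measurable_update_left.comp h.measurable_pi
  have h1 : IndepFun (V i) V' P := by
    rw [IndepFun_iff_Indep]
    have h2 := indep_iSup_of_disjoint (fun j => (h.measurable_V j).comap_le) h.indep_V.iIndep
      (S := {i}) (T := {i}ᶜ) disjoint_compl_right
    refine indep_of_indep_of_le_left (indep_of_indep_of_le_right h2 ?_) ?_
    · rw [← measurable_iff_comap_le]
      refine @measurable_pi_iff _ _ _ (_) _ _ |>.mpr fun j => ?_
      rcases eq_or_ne j i with rfl | hj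
      · simp [hV']
      · simp only [hV', Function.update_of_ne hj]
        rw [measurable_iff_comap_le]
        exact le_iSup₂_of_le j hj le_rfl
    · exact le_iSup₂_of_le i rfl le_rfl
  have h3 : IndepFun (fun ω => (V i ω, V' ω)) Z P := by
    have hm : Measurable fun v : ι → ℝ => (v i, Function.update v i (0 : ℝ)) :=
      (measurable_pi_apply i).prodMk measurable_update_left
    exact h.indep_V_Z.comp hm measurable_id
  rw [indepFun_iff_map_prod_eq_prod_map_map (h.measurable_V i).aemeasurable
    (hm'.prodMk h.measurable_Z).aemeasurable]
  rw [indepFun_iff_map_prod_eq_prod_map_map (h.measurable_V i).aemeasurable hm'.aemeasurable] at h1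
  have h4 := (indepFun_iff_map_prod_eq_prod_map_map ((h.measurable_V i).prodMk hm').aemeasurable
    h.measurable_Z.aemeasurable).mp h3
  have h5 : IndepFun V' Z P := h3.comp measurable_snd measurable_id
  rw [indepFun_iff_map_prod_eq_prod_map_map hm'.aemeasurable h.measurable_Z.aemeasurable] at h5
  have := Measure.isProbabilityMeasure_map (μ := P) (h.measurable_V i).aemeasurable
  have := Measure.isProbabilityMeasure_map (μ := P) hm'.aemeasurable
  have := Measure.isProbabilityMeasure_map (μ := P) h.measurable_Z.aemeasurable
  rw [h5, ← Measure.prodAssoc_prod, ← h1, ← h4, Measure.map_map (by fun_prop)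
    (((h.measurable_V i).prodMk hm').prodMk h.measurable_Z)]
  rfl

/-- Given everything except `V i`, the value of `η` is frozen by `hi`, and the event puts `V i` in
an interval of length 2ε, which has mass at most 2D₀ε. -/
theorem measure_abs_sub_le (h : IsDiagonalDisorder P V Z ρ D₀) (i : ι)
    {η : (ι → ℝ) × 𝒵 → ℝ} (hη : Measurable η)
    (hi : ∀ v z t, η (Function.update v i t, z) = η (v, z)) {ε : ℝ} (hε : 0 ≤ ε) :
    P.real {ω | |V i ω - η ((fun j => V j ω), Z ω)| ≤ ε} ≤ 2 * D₀ * ε := by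
  have hD : 0 ≤ D₀ := (h.density_nonneg 0).trans (h.density_le 0)
  set Y : Ω → (ι → ℝ) × 𝒵 := fun ω => (Function.update (fun j => V j ω) i 0, Z ω) with hYdef
  have hY : Measurable Y := (measurable_update_left.comp h.measurable_pi).prodMk h.measurable_Z
  have hind := (indepFun_iff_map_prod_eq_prod_map_map (h.measurable_V i).aemeasurable
    hY.aemeasurable).mp (h.indepFun_update i)
  have := Measure.isProbabilityMeasure_map (μ := P) (h.measurable_V i).aemeasurable
  have := Measure.isProbabilityMeasure_map (μ := P) hY.aemeasurable
  let s : Set (ℝ × ((ι → ℝ) × 𝒵)) := {p | |p.1 - η p.2| ≤ ε}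
  have hs : MeasurableSet s :=
    measurableSet_le (measurable_fst.sub (hη.comp measurable_snd)).abs measurable_const
  have heq : {ω | |V i ω - η ((fun j => V j ω), Z ω)| ≤ ε} = (fun ω => (V i ω, Y ω)) ⁻¹' s := by
    ext ω
    simp only [Set.mem_ofPred_eq, Set.mem_preimage, s, hYdef, hi]
  rw [measureReal_def]
  refine ENNReal.toReal_le_of_le_ofReal (by positivity) ?_
  rw [heq, ← Measure.map_apply ((h.measurable_V i).prodMk hY) hs, hind,
    Measure.prod_apply_symm hs]
  calc _ ≤ ∫⁻ _, ENNReal.ofReal (2 * D₀ * ε) ∂P.map Y := lintegral_mono fun y => ?_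
    _ = _ := by simp
  have hsec : (fun x => (x, y)) ⁻¹' s = Set.Icc (η y - ε) (η y + ε) := by
    ext x
    simp only [s, Set.mem_preimage, Set.mem_ofPred_eq, Set.mem_Icc, abs_le]
    constructor <;> rintro ⟨h1, h2⟩ <;> constructor <;> linarith
  rw [hsec, h.law_V i, withDensity_apply _ measurableSet_Icc]
  calc _ ≤ ∫⁻ _ in Set.Icc (η y - ε) (η y + ε), ENNReal.ofReal D₀ :=
        lintegral_mono fun t => ENNReal.ofReal_le_ofReal (h.density_le t)
    _ = _ := by
      rw [setLIntegral_const, Real.volume_Icc, ← ENNReal.ofReal_mul hD]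
      congr 1; ring

theorem ae_ne (h : IsDiagonalDisorder P V Z ρ D₀) (i : ι)
    {η : (ι → ℝ) × 𝒵 → ℝ} (hη : Measurable η)
    (hi : ∀ v z t, η (Function.update v i t, z) = η (v, z)) :
    ∀ᵐ ω ∂P, V i ω - η ((fun j => V j ω), Z ω) ≠ 0 := by
  have := h.measure_abs_sub_le i hη hi le_rfl
  rw [mul_zero, (measureReal_nonneg).ge_iff_eq', measureReal_eq_zero_iff] at this
  rw [ae_iff]
  simpa using this

end IsDiagonalDisorder

theorem measurable_matrix_det {X n : Type*} [MeasurableSpace X] [Fintype n] [DecidableEq n]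
    {M : X → Matrix n n ℝ} (hM : ∀ i j, Measurable fun x => M x i j) :
    Measurable fun x => (M x).det := by
  simp only [Matrix.det_apply']
  fun_prop

theorem measurable_matrix_inv {X n : Type*} [MeasurableSpace X] [Fintype n] [DecidableEq n]
    {M : X → Matrix n n ℝ} (hM : ∀ i j, Measurable fun x => M x i j) (i j : n) :
    Measurable fun x => (M x)⁻¹ i j := by
  simp only [Matrix.inv_def, Matrix.smul_apply, Ring.inverse_eq_inv', smul_eq_mul,
    Matrix.adjugate_apply]
  refine (measurable_matrix_det hM).inv.mul (measurable_matrix_det fun k l => ?_)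
  rcases eq_or_ne k j with rfl | hk
  · simp
  · simpa [Matrix.updateRow_apply, hk] using hM k l

theorem measureReal_le_of_ae_le {Ω : Type*} [MeasurableSpace Ω] {P : Measure Ω}
    [IsFiniteMeasure P] {s t : Set Ω} (h : s ≤ᵐ[P] t) : P.real s ≤ P.real t :=
  ENNReal.toReal_mono (measure_ne_top _ _) (measure_mono_ae h)

/-! ### Resolvent bounds, integrability of log-determinants, tightness of self-energies -/

namespace IsDiagonalDisorder

variable {Ω ι 𝒵 : Type*} [MeasurableSpace Ω] [MeasurableSpace 𝒵] [DecidableEq ι]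
  {P : Measure Ω} {V : ι → Ω → ℝ} {Z : Ω → 𝒵} {ρ : ℝ → ℝ} {D₀ : ℝ}
  {B : 𝒵 → Matrix ι ι ℝ}

theorem measurable_entry (hB : ∀ i j, Measurable fun z => B z i j) (i j : ι) :
    Measurable fun p : (ι → ℝ) × 𝒵 => (Matrix.diagonal p.1 + B p.2) i j := by
  simp only [Matrix.add_apply, Matrix.diagonal_apply]
  split_ifs
  · exact ((measurable_pi_apply i).comp measurable_fst).add ((hB i j).comp measurable_snd)
  · exact measurable_const.add ((hB i j).comp measurable_snd)

theorem measurable_inv_principal (hB : ∀ i j, Measurable fun z => B z i j) (S : Finset ι)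
    (m l : S) : Measurable fun p : (ι → ℝ) × 𝒵 =>
      (principal (Matrix.diagonal p.1 + B p.2) S)⁻¹ m l :=
  measurable_matrix_inv (M := fun p : (ι → ℝ) × 𝒵 => principal (Matrix.diagonal p.1 + B p.2) S)
    (fun _ _ => measurable_entry hB _ _) m l

theorem measurable_det_principal (hB : ∀ i j, Measurable fun z => B z i j) (S : Finset ι) :
    Measurable fun p : (ι → ℝ) × 𝒵 => (principal (Matrix.diagonal p.1 + B p.2) S).det :=
  measurable_matrix_det fun _ _ => measurable_entry hB _ _

theorem measurable_schur (hB : ∀ i j, Measurable fun z => B z i j) (S : Finset ι) (i j : ι) :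
    Measurable fun p : (ι → ℝ) × 𝒵 => schur (Matrix.diagonal p.1 + B p.2) S i j := by
  refine (measurable_entry hB _ _).sub (Finset.measurable_sum _ fun m _ =>
    Finset.measurable_sum _ fun l _ => ?_)
  exact ((measurable_entry hB _ _).mul (measurable_inv_principal hB S m l)).mul
    (measurable_entry hB _ _)

theorem measurable_selfEnergy (hB : ∀ i j, Measurable fun z => B z i j) (S : Finset ι) (i : ι) :
    Measurable fun p : (ι → ℝ) × 𝒵 => selfEnergy (B p.2) S i p.1 :=
  ((measurable_pi_apply i).comp measurable_fst).sub (measurable_schur hB S i i)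

variable [IsProbabilityMeasure P]

theorem ae_sub_selfEnergy_ne_zero (h : IsDiagonalDisorder P V Z ρ D₀)
    (hB : ∀ i j, Measurable fun z => B z i j) {S : Finset ι} {i : ι} (hi : i ∉ S) :
    ∀ᵐ ω ∂P, V i ω - selfEnergy (B (Z ω)) S i (fun j => V j ω) ≠ 0 :=
  h.ae_ne i (η := fun p => selfEnergy (B p.2) S i p.1) (measurable_selfEnergy hB S i)
    fun v z t => selfEnergy_update (B z) hi v t

theorem ae_det_ne_zero (h : IsDiagonalDisorder P V Z ρ D₀)
    (hB : ∀ i j, Measurable fun z => B z i j) (S : Finset ι) :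
    ∀ᵐ ω ∂P, (principal (Matrix.diagonal (fun j => V j ω) + B (Z ω)) S).det ≠ 0 := by
  induction S using Finset.induction_on with
  | empty => exact Filter.Eventually.of_forall fun ω => by simp
  | insert i S hi ih =>
    filter_upwards [ih, h.ae_sub_selfEnergy_ne_zero hB hi] with ω h1 h2
    rw [det_principal_insert _ hi h1]
    refine mul_ne_zero h1 ?_
    simpa [selfEnergy] using h2

/-- Weak `L¹` bound on the entries of the inverses of the principal submatrices. -/
theorem measure_le_abs_inv_principal (h : IsDiagonalDisorder P V Z ρ D₀)
    (hB : ∀ i j, Measurable fun z => B z i j) (hsymm : ∀ ω, (B (Z ω)).IsSymm) (S : Finset ι)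
    (j k : S) {T : ℝ} (hT : 0 < T) :
    P.real {ω | T ≤ |(principal (Matrix.diagonal (fun j => V j ω) + B (Z ω)) S)⁻¹ j k|} ≤
      8 * D₀ / T := by
  have hD : 0 ≤ D₀ := (h.density_nonneg 0).trans (h.density_le 0)
  have hT' : 0 ≤ T⁻¹ := (inv_pos.mpr hT).le
  obtain ⟨j, hj⟩ := j
  obtain ⟨k, hk⟩ := k
  rcases eq_or_ne j k with rfl | hjk
  · have hnot : j ∉ S \ {j} := by simp
    have hle := h.measure_abs_sub_le j (η := fun p => selfEnergy (B p.2) (S \ {j}) j p.1)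
      (measurable_selfEnergy hB _ j) (fun v z t => selfEnergy_update (B z) hnot v t) hT'
    refine le_trans (measureReal_le_of_ae_le ?_) (hle.trans ?_)
    · filter_upwards [h.ae_det_ne_zero hB S, h.ae_det_ne_zero hB (S \ {j})] with ω h1 h2 h3
      have h4 := schur_mul_inv_principal_diag _ hj h2 h1
      have h3' : T ≤ |(principal (Matrix.diagonal (fun j => V j ω) + B (Z ω)) S)⁻¹
        ⟨j, hj⟩ ⟨j, hj⟩| := h3
      change |V j ω - selfEnergy (B (Z ω)) (S \ {j}) j (fun j => V j ω)| ≤ T⁻¹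
      rw [selfEnergy, sub_sub_cancel, eq_inv_of_mul_eq_one_left h4, abs_inv]
      exact inv_anti₀ hT h3'
    · rw [div_eq_mul_inv]
      gcongr
      norm_num
  -- Off the diagonal, remove both sites: the Schur complement on {j, k} has diagonal V_j − x, V_k −
  -- y and off-diagonal entry c.
  · set R := S \ {j, k} with hR
    have hjR : j ∉ R := by simp [hR]
    have hkR : k ∉ R := by simp [hR]
    let x (p : (ι → ℝ) × 𝒵) := selfEnergy (B p.2) R j p.1
    let y (p : (ι → ℝ) × 𝒵) := selfEnergy (B p.2) R k p.1
    let sx (p : (ι → ℝ) × 𝒵) := schur (Matrix.diagonal p.1 + B p.2) R j j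
    let sy (p : (ι → ℝ) × 𝒵) := schur (Matrix.diagonal p.1 + B p.2) R k k
    let c (p : (ι → ℝ) × 𝒵) := schur (Matrix.diagonal p.1 + B p.2) R j k
    have hxm : Measurable x := measurable_selfEnergy hB R j
    have hym : Measurable y := measurable_selfEnergy hB R k
    have hsxm : Measurable sx := measurable_schur hB R j j
    have hsym : Measurable sy := measurable_schur hB R k k
    have hcm : Measurable c := measurable_schur hB R j k
    have hx (v z t) : x (Function.update v j t, z) = x (v, z) := selfEnergy_update _ hjR v t
    have hy (v z t) : y (Function.update v k t, z) = y (v, z) := selfEnergy_update _ hkR v t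
    have hsx (v z t) : sx (Function.update v k t, z) = sx (v, z) :=
      schur_diagonal_update_add_of_ne _ v hkR t (Or.inl hjk)
    have hsy (v z t) : sy (Function.update v j t, z) = sy (v, z) :=
      schur_diagonal_update_add_of_ne _ v hjR t (Or.inl hjk.symm)
    have hcj (v z t) : c (Function.update v j t, z) = c (v, z) :=
      schur_diagonal_update_add_of_ne _ v hjR t (Or.inr hjk.symm)
    have hck (v z t) : c (Function.update v k t, z) = c (v, z) :=
      schur_diagonal_update_add_of_ne _ v hkR t (Or.inl hjk)
    -- One estimate for each alternative of `abs_sub_le_of_le_abs_offDiag`. Each centre is free of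
    -- the variable it is compared with, and 4 · 2D₀/T gives the constant 8.
    have e1 := h.measure_abs_sub_le j (η := fun p => x p + c p ^ 2 / sy p)
      (by fun_prop) (fun v z t => by simp only [hx, hcj, hsy]) hT'
    have e2 := h.measure_abs_sub_le k (η := fun p => y p + c p ^ 2 / sx p)
      (by fun_prop) (fun v z t => by simp only [hy, hck, hsx]) hT'
    have e3 := h.measure_abs_sub_le j (η := fun p => x p + |c p|)
      (by fun_prop) (fun v z t => by simp only [hx, hcj]) hT'
    have e4 := h.measure_abs_sub_le j (η := fun p => x p + -|c p|)
      (by fun_prop) (fun v z t => by simp only [hx, hcj]) hT'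
    refine le_trans (measureReal_le_of_ae_le (t := _ ∪ (_ ∪ (_ ∪ _))) ?_)
      ((measureReal_union_le _ _).trans (add_le_add e1 ((measureReal_union_le _ _).trans
        (add_le_add e2 ((measureReal_union_le _ _).trans (add_le_add e3 e4))))) |>.trans
        (le_of_eq ?_))
    · filter_upwards [h.ae_det_ne_zero hB S, h.ae_det_ne_zero hB R] with ω h1 h2 h3
      have hA : (Matrix.diagonal (fun j => V j ω) + B (Z ω)).IsSymm :=
        (Matrix.isSymm_diagonal _).add (hsymm _)
      obtain ⟨h4, h5⟩ := schur_mul_inv_principal_offDiag hA hjk hj hk h2 h1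
      have := abs_sub_le_of_le_abs_offDiag hT h4 h5 h3
      rw [← hR] at this
      have hVj : V j ω = x (fun j => V j ω, Z ω) + sx (fun j => V j ω, Z ω) := by
        simp [x, sx, selfEnergy]
      have hVk : V k ω = y (fun j => V j ω, Z ω) + sy (fun j => V j ω, Z ω) := by
        simp [y, sy, selfEnergy]
      change |(V j ω : ℝ) - _| ≤ T⁻¹ ∨ |(V k ω : ℝ) - _| ≤ T⁻¹ ∨ |(V j ω : ℝ) - _| ≤ T⁻¹ ∨
        |(V j ω : ℝ) - _| ≤ T⁻¹
      rw [hVj, hVk]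
      simp only [add_sub_add_left_eq_sub]
      exact this
    · rw [div_eq_mul_inv]; ring

section LogDet

variable (h : IsDiagonalDisorder P V Z ρ D₀) (hB : ∀ i j, Measurable fun z => B z i j)
  (hsymm : ∀ ω, (B (Z ω)).IsSymm)

include h hB hsymm

theorem logSqIntegrable_inv_principal (S : Finset ι) (m l : S) : LogSqIntegrable P
    fun ω => (principal (Matrix.diagonal (fun j => V j ω) + B (Z ω)) S)⁻¹ m l := by
  have hm := (measurable_inv_principal hB S m l).comp h.measurable_pair
  refine LogSqIntegrable.of_tail (C := 8 * D₀) hm fun T hT => ?_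
  exact h.measure_le_abs_inv_principal hB hsymm S m l (one_pos.trans_le hT)

theorem logSqIntegrable_selfEnergy (hBL : ∀ i j, LogSqIntegrable P fun ω => B (Z ω) i j)
    {S : Finset ι} {i : ι} (hi : i ∉ S) : LogSqIntegrable P
      fun ω => selfEnergy (B (Z ω)) S i (fun j => V j ω) := by
  simp only [selfEnergy_eq _ hi]
  exact (hBL i i).neg.add (.sum _ fun m _ => .sum _ fun l _ =>
    ((hBL _ _).mul (h.logSqIntegrable_inv_principal hB hsymm S m l)).mul (hBL _ _))

/-- Growth at infinity is inherited from `V i` and the self-energy; near zero, the bounded density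
of `V i` gives the inverse of the difference a tail 2D₀/T. -/
theorem memLp_log_sub_selfEnergy (hBL : ∀ i j, LogSqIntegrable P fun ω => B (Z ω) i j)
    (hV : ∀ i, LogSqIntegrable P (V i)) {S : Finset ι} {i : ι} (hi : i ∉ S) :
    MemLp (fun ω => Real.log |V i ω - selfEnergy (B (Z ω)) S i (fun j => V j ω)|) 2 P := by
  have hm : Measurable fun ω => selfEnergy (B (Z ω)) S i (fun j => V j ω) :=
    (measurable_selfEnergy hB S i).comp h.measurable_pair
  refine LogSqIntegrable.memLp_log_abs ?_ ?_
  · simpa only [sub_eq_add_neg] using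
      (hV i).add (h.logSqIntegrable_selfEnergy hB hsymm hBL hi).neg
  · refine .of_tail ((h.measurable_V i).sub hm).inv (C := 2 * D₀) fun T hT => ?_
    have hT0 : 0 < T := one_pos.trans_le hT
    have := h.measure_abs_sub_le i (η := fun p => selfEnergy (B p.2) S i p.1)
      (measurable_selfEnergy hB S i) (fun v z t => selfEnergy_update (B z) hi v t)
      (inv_pos.mpr hT0).le
    refine (measureReal_mono fun ω hω => ?_).trans this
    have hω' : T ≤ |(V i ω - selfEnergy (B (Z ω)) S i (fun j => V j ω))⁻¹| := hω
    rw [abs_inv] at hω'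
    exact le_inv_of_le_inv₀ hT0 hω'

theorem memLp_log_det (hBL : ∀ i j, LogSqIntegrable P fun ω => B (Z ω) i j)
    (hV : ∀ i, LogSqIntegrable P (V i)) (S : Finset ι) :
    MemLp (fun ω => Real.log
      |(principal (Matrix.diagonal (fun j => V j ω) + B (Z ω)) S).det|) 2 P := by
  induction S using Finset.induction_on with
  | empty => simp
  | insert i S hi ih =>
    refine (ih.add (h.memLp_log_sub_selfEnergy hB hsymm hBL hV hi)).ae_eq ?_
    filter_upwards [h.ae_det_ne_zero hB S, h.ae_sub_selfEnergy_ne_zero hB hi] with ω h1 h2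
    rw [det_principal_insert _ hi h1, abs_mul, Real.log_mul (abs_ne_zero.mpr h1)]
    · simp [selfEnergy]
    · simpa [selfEnergy] using h2

/-- The self-energy is bounded in probability, uniformly in the finite set, when each row has few
nonzero entries. -/
theorem measure_le_abs_selfEnergy {i : ι} {N : Finset ι}
    (hN : ∀ ω j, j ≠ i → j ∉ N → B (Z ω) i j = 0) {R p : ℝ} (hR : 0 ≤ R)
    (hp : P.real {ω | ∃ j, R ≤ |B (Z ω) i j|} ≤ p) {T : ℝ} (hT : 0 < T) {S : Finset ι}
    (hi : i ∉ S) :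
    P.real {ω | R + (N.card : ℝ) ^ 2 * (R ^ 2 * T) ≤
      |selfEnergy (B (Z ω)) S i (fun j => V j ω)|} ≤ p + (N.card : ℝ) ^ 2 * (8 * D₀ / T) := by
  have hD : 0 ≤ D₀ := (h.density_nonneg 0).trans (h.density_le 0)
  let F : Finset S := Finset.univ.filter fun m => m.1 ∈ N
  have hF : (F.card : ℝ) ≤ N.card := by
    refine mod_cast Finset.card_le_card_of_injOn (fun m => m.1) ?_ Subtype.val_injective.injOn
    intro m hm
    simpa [F] using hm
  let G (ω : Ω) := (principal (Matrix.diagonal (fun j => V j ω) + B (Z ω)) S)⁻¹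
  -- Off the exceptional events, the row entries are below `R` and the resolvent entries between
  -- neighbours below `T`; only pairs of neighbours contribute to the double sum, whatever the size
  -- of `S`.
  have hsub : {ω | R + (N.card : ℝ) ^ 2 * (R ^ 2 * T) ≤
      |selfEnergy (B (Z ω)) S i (fun j => V j ω)|} ⊆
      {ω | ∃ j, R ≤ |B (Z ω) i j|} ∪ ⋃ q ∈ F ×ˢ F, {ω | T ≤ |G ω q.1 q.2|} := by
    intro ω hω
    by_contra hcon
    simp only [Set.mem_union, Set.mem_ofPred_eq, Set.mem_iUnion, not_or, not_exists, not_le,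
      Finset.mem_product, and_imp, Prod.forall] at hcon hω
    obtain ⟨h1, h2⟩ := hcon
    have hz (m : S) (hm : m ∉ F) : B (Z ω) i m = 0 :=
      hN _ _ (fun h => hi (h ▸ m.2)) (by simpa [F] using hm)
    refine absurd hω (not_le.mpr ?_)
    rw [selfEnergy_eq _ hi]
    have hsum : |∑ m : S, ∑ l : S, B (Z ω) i m * G ω m l * B (Z ω) l i| ≤
        (N.card : ℝ) ^ 2 * (R ^ 2 * T) := by
      have : ∑ m : S, ∑ l : S, B (Z ω) i m * G ω m l * B (Z ω) l i =
          ∑ m ∈ F, ∑ l ∈ F, B (Z ω) i m * G ω m l * B (Z ω) l i := by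
        rw [← Finset.sum_subset (Finset.subset_univ F) fun m _ hm => by simp [hz m hm]]
        refine Finset.sum_congr rfl fun m _ => ?_
        rw [← Finset.sum_subset (Finset.subset_univ F) fun l _ hl => by
          simp [(hsymm ω).apply i l, hz l hl]]
      rw [this]
      calc _ ≤ ∑ m ∈ F, ∑ l ∈ F, |B (Z ω) i m * G ω m l * B (Z ω) l i| :=
            (Finset.abs_sum_le_sum_abs _ _).trans
              (Finset.sum_le_sum fun m _ => Finset.abs_sum_le_sum_abs _ _)
        _ ≤ ∑ m ∈ F, ∑ l ∈ F, R ^ 2 * T := by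
          refine Finset.sum_le_sum fun m hm => Finset.sum_le_sum fun l hl => ?_
          rw [abs_mul, abs_mul, (hsymm ω).apply i l]
          calc _ ≤ R * T * R := by
                gcongr
                · exact (h1 m).le
                · exact (h2 m l hm hl).le
                · exact (h1 l).le
            _ = _ := by ring
        _ = (F.card : ℝ) ^ 2 * (R ^ 2 * T) := by simp; ring
        _ ≤ _ := by gcongr
    calc _ ≤ |-B (Z ω) i i| + _ := abs_add_le _ _
      _ < _ := by rw [abs_neg]; exact add_lt_add_of_lt_of_le (h1 i) hsum
  refine (measureReal_mono hsub).trans ((measureReal_union_le _ _).trans (add_le_add hp ?_))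
  calc _ ≤ ∑ q ∈ F ×ˢ F, P.real {ω | T ≤ |G ω q.1 q.2|} := measureReal_biUnion_finset_le _ _
    _ ≤ ∑ q ∈ F ×ˢ F, 8 * D₀ / T :=
      Finset.sum_le_sum fun q _ => h.measure_le_abs_inv_principal hB hsymm S q.1 q.2 hT
    _ = (F.card : ℝ) ^ 2 * (8 * D₀ / T) := by rw [Finset.sum_const, Finset.card_product, nsmul_eq_mul, Nat.cast_mul]; ring
    _ ≤ _ := by gcongr

end LogDet

end IsDiagonalDisorder

/-! ### A test function with controlled logarithmic potential -/

/-- The second difference of `x ↦ x log |x|`. -/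
def mulLogSecondDiff (y : ℝ) : ℝ :=
  (y + 1) * Real.log (y + 1) - 2 * (y * Real.log y) + (y - 1) * Real.log (y - 1)

theorem continuous_mulLogSecondDiff : Continuous mulLogSecondDiff := by
  have h := Real.continuous_mul_log
  exact ((h.comp (continuous_id.add continuous_const)).sub (h.const_mul 2)).add
    (h.comp (continuous_id.sub continuous_const))

/-- The value at 2, which corresponds to ξ = 0, is log(27/16) ≥ 11/27 > 1/4; continuity does the
rest. -/
theorem exists_quarter_le_mulLogSecondDiff :
    ∃ ε > 0, ∀ y, |y - 2| < ε → 1 / 4 ≤ mulLogSecondDiff y := by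
  have h2 : 1 / 4 < mulLogSecondDiff 2 := by
    have h3 : Real.log (2 + 1) = Real.log 3 := by norm_num
    have h4 : mulLogSecondDiff 2 = - Real.log (16 / 27) := by
      rw [Real.log_div (by norm_num) (by norm_num), show (16 : ℝ) = 2 ^ 4 by norm_num,
        show (27 : ℝ) = 3 ^ 3 by norm_num, Real.log_pow, Real.log_pow, mulLogSecondDiff, h3]
      norm_num
      ring
    have := Real.log_le_sub_one_of_pos (show (0 : ℝ) < 16 / 27 by norm_num)
    rw [h4]
    linarith
  obtain ⟨ε, hε, h⟩ := Metric.eventually_nhds_iff.mp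
    (continuous_mulLogSecondDiff.continuousAt.eventually (lt_mem_nhds h2))
  exact ⟨ε, hε, fun y hy => (h (by rwa [Real.dist_eq])).le⟩

/-- The function is continuous and behaves like (x log|x|)'' = 1/x far out, hence is bounded below.
Compactness covers [−2, 2], elementary logarithm inequalities the rest. -/
theorem exists_neg_le_mulLogSecondDiff : ∃ C > 0, ∀ y, -C ≤ mulLogSecondDiff y := by
  obtain ⟨C, hC⟩ := (isCompact_Icc (a := (-2 : ℝ)) (b := 2)).exists_bound_of_continuousOn
    continuous_mulLogSecondDiff.continuousOn
  refine ⟨max C 2, by positivity, fun y => ?_⟩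
  rcases le_or_gt 2 y with h2 | h2
  · refine (neg_le_neg (le_max_right _ _)).trans ?_
    have e1 : Real.log (y + 1) - Real.log (y - 1) ≥ 0 :=
      sub_nonneg.mpr (Real.log_le_log (by linarith) (by linarith))
    have e2 : 2 * Real.log y - Real.log (y + 1) - Real.log (y - 1) ≤ 1 / (y ^ 2 - 1) := by
      have h0 : 0 < y ^ 2 - 1 := by nlinarith
      have : 2 * Real.log y - Real.log (y + 1) - Real.log (y - 1)
          = Real.log (y ^ 2 / (y ^ 2 - 1)) := by
        rw [Real.log_div (by positivity) h0.ne', Real.log_pow,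
          show y ^ 2 - 1 = (y + 1) * (y - 1) by ring,
          Real.log_mul (by linarith) (by linarith)]
        push_cast; ring
      rw [this]
      refine (Real.log_le_sub_one_of_pos (by positivity)).trans (le_of_eq ?_)
      field_simp; ring
    have e3 : y * (1 / (y ^ 2 - 1)) ≤ 2 := by
      rw [mul_one_div, div_le_iff₀ (by nlinarith)]; nlinarith
    have e4 := mul_le_mul_of_nonneg_left e2 (show 0 ≤ y by linarith)
    rw [mulLogSecondDiff]
    linarith
  rcases le_or_gt y (-2) with h3 | h3
  · refine (neg_le_neg (le_max_right _ _)).trans ?_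
    obtain ⟨z, rfl⟩ : ∃ z, y = -z := ⟨-y, by ring⟩
    have hz : 2 ≤ z := by linarith
    have e0 : mulLogSecondDiff (-z) = z * (2 * Real.log z - Real.log (z + 1) - Real.log (z - 1)) -
        (Real.log (z + 1) - Real.log (z - 1)) := by
      rw [mulLogSecondDiff, show -z + 1 = -(z - 1) by ring, show -z - 1 = -(z + 1) by ring,
        Real.log_neg_eq_log, Real.log_neg_eq_log, Real.log_neg_eq_log]
      ring
    have e1 : 0 ≤ 2 * Real.log z - Real.log (z + 1) - Real.log (z - 1) := by
      have : Real.log ((z + 1) * (z - 1)) ≤ Real.log (z ^ 2) :=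
        Real.log_le_log (by nlinarith) (by nlinarith)
      rw [Real.log_mul (by linarith) (by linarith), Real.log_pow] at this
      push_cast at this
      linarith
    have e2 : Real.log (z + 1) - Real.log (z - 1) ≤ 2 := by
      rw [← Real.log_div (by linarith) (by linarith)]
      refine (Real.log_le_sub_one_of_pos (div_pos (by linarith) (by linarith))).trans ?_
      rw [tsub_le_iff_right, div_le_iff₀ (by linarith)]
      linarith
    have := mul_nonneg (show 0 ≤ z by linarith) e1
    linarith
  · have := hC y ⟨h3.le, h2.le⟩
    rw [Real.norm_eq_abs, abs_le] at this
    exact (neg_le_neg (le_max_left _ _)).trans this.1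

/-- A bounded function on `I` of mean zero whose logarithmic potential is at least `a` near the
origin and at least `-b` everywhere. -/
structure IsLogTest (I : Set ℝ) (h : ℝ → ℝ) (a b r : ℝ) : Prop where
  measurable : Measurable h
  abs_le_one : ∀ t, |h t| ≤ 1
  eq_zero : ∀ t, t ∉ I → h t = 0
  integral_eq_zero : ∫ t, h t = 0
  le_of_abs_lt : ∀ ξ, |ξ| < r → a ≤ ∫ t, h t * Real.log |t - ξ|
  neg_le : ∀ ξ, -b ≤ ∫ t, h t * Real.log |t - ξ|

theorem IsLogTest.comp_neg {I J : Set ℝ} {h : ℝ → ℝ} {a b r : ℝ} (hh : IsLogTest I h a b r)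
    (hJ : ∀ t, -t ∈ I → t ∈ J) : IsLogTest J (fun t => h (-t)) a b r := by
  have key (ξ : ℝ) : ∫ t, h (-t) * Real.log |t - ξ| = ∫ t, h t * Real.log |t - -ξ| := by
    rw [← integral_neg_eq_self (fun t => h t * Real.log |t - -ξ|)]
    congr 1
    ext t
    rw [show -t - -ξ = -(t - ξ) by ring, abs_neg]
  refine ⟨hh.measurable.comp measurable_neg, fun t => hh.abs_le_one _,
    fun t ht => hh.eq_zero _ fun h => ht (hJ t h), ?_, fun ξ hξ => ?_, fun ξ => ?_⟩
  · rw [integral_neg_eq_self h]; exact hh.integral_eq_zero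
  · rw [key]; exact hh.le_of_abs_lt _ (by rwa [abs_neg])
  · rw [key]; exact hh.neg_le _

theorem integral_step_mul {M : ℝ} (hM : 0 < M) {g : ℝ → ℝ}
    (hg : ∀ a b, IntervalIntegrable g volume a b) :
    ∫ t, ((Set.Ioc (2 * M) (3 * M)).indicator 1 t - (Set.Ioc M (2 * M)).indicator 1 t) * g t =
      (∫ t in (2 * M)..(3 * M), g t) - ∫ t in M..(2 * M), g t := by
  have h (a b : ℝ) (hab : a ≤ b) : Integrable (fun t => (Set.Ioc a b).indicator 1 t * g t) ∧
      ∫ t, (Set.Ioc a b).indicator 1 t * g t = ∫ t in a..b, g t := by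
    have : (fun t => (Set.Ioc a b).indicator 1 t * g t) = (Set.Ioc a b).indicator g := by
      ext t; by_cases ht : t ∈ Set.Ioc a b <;> simp [ht]
    rw [this, integral_indicator measurableSet_Ioc, intervalIntegral.integral_of_le hab]
    exact ⟨((intervalIntegrable_iff_integrableOn_Ioc_of_le hab).mp (hg a b)).integrable_indicator
      measurableSet_Ioc, rfl⟩
  simp only [sub_mul]
  rw [integral_sub (h _ _ (by linarith)).1 (h _ _ (by linarith)).1, (h _ _ (by linarith)).2,
    (h _ _ (by linarith)).2]

/-- An antiderivative of the logarithm is x log|x| − x, and the difference of the two integrals is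
its second difference with step M. Linear terms cancel, including those in log M from rescaling, so
the potential is exactly homogeneous. -/
theorem integral_step_mul_log {M : ℝ} (hM : 0 < M) (ξ : ℝ) :
    ∫ t, ((Set.Ioc (2 * M) (3 * M)).indicator 1 t - (Set.Ioc M (2 * M)).indicator 1 t) *
      Real.log |t - ξ| = M * mulLogSecondDiff (2 - ξ / M) := by
  have hlog (x : ℝ) : (M * x) * Real.log (M * x) = M * (x * Real.log x) + M * x * Real.log M := by
    rcases eq_or_ne x 0 with rfl | hx
    · simp
    · rw [Real.log_mul hM.ne' hx]; ring
  have hint (a b : ℝ) : IntervalIntegrable (fun t => Real.log (t - ξ)) volume a b := by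
    simpa using (intervalIntegral.intervalIntegrable_log' (a := a - ξ) (b := b - ξ)).comp_sub_right ξ
  simp only [Real.log_abs]
  rw [integral_step_mul hM hint,
    intervalIntegral.integral_comp_sub_right (fun t => Real.log t),
    intervalIntegral.integral_comp_sub_right (fun t => Real.log t), integral_log, integral_log,
    show 3 * M - ξ = M * (2 - ξ / M + 1) by field_simp; ring,
    show 2 * M - ξ = M * (2 - ξ / M) by field_simp,
    show M - ξ = M * (2 - ξ / M - 1) by field_simp; ring, hlog, hlog, hlog, mulLogSecondDiff]
  ring

/-- The step function +1 on (2M, 3M], −1 on (M, 2M]. By scaling, `ε` and `C` are absolute. -/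
theorem exists_isLogTest : ∃ ε > 0, ∃ C > 0, ∀ M > 0,
    ∃ h, IsLogTest (Set.Icc M (3 * M)) h (M / 4) (C * M) (ε * M) := by
  obtain ⟨ε, hε, h1⟩ := exists_quarter_le_mulLogSecondDiff
  obtain ⟨C, hC, h2⟩ := exists_neg_le_mulLogSecondDiff
  refine ⟨ε, hε, C, hC, fun M hM => ⟨fun t => (Set.Ioc (2 * M) (3 * M)).indicator 1 t -
    (Set.Ioc M (2 * M)).indicator 1 t, ?_, fun t => ?_, fun t ht => ?_, ?_, fun ξ hξ => ?_,
    fun ξ => ?_⟩⟩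
  · exact (measurable_one.indicator measurableSet_Ioc).sub
      (measurable_one.indicator measurableSet_Ioc)
  · simp only [Set.indicator_apply, Pi.one_apply]
    split_ifs <;> norm_num
  · rw [Set.indicator_of_notMem, Set.indicator_of_notMem, sub_zero]
    · exact fun h => ht ⟨h.1.le, by linarith [h.2]⟩
    · exact fun h => ht ⟨by linarith [h.1], h.2⟩
  · have := integral_step_mul hM (g := fun _ => 1) (fun _ _ => intervalIntegrable_const)
    simp only [mul_one, intervalIntegral.integral_const, smul_eq_mul] at this
    rw [this]; ring
  · rw [integral_step_mul_log hM]
    have := h1 (2 - ξ / M) (by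
      rwa [show 2 - ξ / M - 2 = -(ξ / M) by ring, abs_neg, abs_div, abs_of_pos hM, div_lt_iff₀ hM])
    nlinarith
  · rw [integral_step_mul_log hM]
    nlinarith [h2 (2 - ξ / M)]

/-! ### From covariances with single-site functions to the variance -/

/-- A Bessel-type lower bound for the variance of `F` in terms of its covariances with pairwise
independent random variables. -/
theorem le_variance_of_le_covariance {Ω ι : Type*} [MeasurableSpace Ω] {P : Measure Ω}
    [IsProbabilityMeasure P] {F : Ω → ℝ} (hF : MemLp F 2 P) {X : ι → Ω → ℝ} {s : Finset ι}
    (hX : ∀ i ∈ s, MemLp (X i) 2 P) (hind : Set.Pairwise ↑s fun i j => X i ⟂ᵢ[P] X j)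
    {q w c : ℝ} (hc : 0 ≤ c) (hq : ∀ i ∈ s, q ≤ cov[F, X i; P]) (hw : ∀ i ∈ s, Var[X i; P] ≤ w) :
    s.card * (2 * c * q - c ^ 2 * w) ≤ Var[F; P] := by
  have hS : MemLp (∑ i ∈ s, X i) 2 P := memLp_finsetSum' s hX
  -- Expand this variance; pairwise independence leaves only the diagonal terms of the sum.
  have h0 : 0 ≤ Var[F - c • ∑ i ∈ s, X i; P] := variance_nonneg _ _
  rw [variance_sub hF (hS.const_smul c), covariance_smul_right, variance_smul,
    IndepFun.variance_sum hX hind, covariance_sum_right' hX hF] at h0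
  have h1 := Finset.card_nsmul_le_sum s _ q hq
  have h2 := Finset.sum_le_card_nsmul s _ w hw
  rw [nsmul_eq_mul] at h1 h2
  have h3 := mul_le_mul_of_nonneg_left h1 hc
  have h4 := mul_le_mul_of_nonneg_left h2 (sq_nonneg c)
  linarith

theorem integral_eq_of_law_withDensity {Ω : Type*} [MeasurableSpace Ω] {P : Measure Ω}
    {X : Ω → ℝ} (hX : Measurable X) {ρ : ℝ → ℝ} (hρ : Measurable ρ) (hρ0 : ∀ t, 0 ≤ ρ t)
    (hlaw : P.map X = volume.withDensity fun t => ENNReal.ofReal (ρ t)) {g : ℝ → ℝ}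
    (hg : Measurable g) : ∫ ω, g (X ω) ∂P = ∫ t, g t * ρ t := by
  rw [← integral_map hX.aemeasurable hg.aestronglyMeasurable, hlaw,
    integral_withDensity_eq_integral_toReal_smul (by fun_prop)
      (Filter.Eventually.of_forall fun _ => ENNReal.ofReal_lt_top)]
  simp [ENNReal.toReal_ofReal (hρ0 _), mul_comm]

/-- Given `Y`, the relation φρ = m·h turns the expectation over `X` into `m` times the potential of
`h` at `ξ(Y)`: at least `a` when |ξ| < r, at least `-b` otherwise. -/
theorem le_integral_log_mul {Ω 𝒴 : Type*} [MeasurableSpace Ω] [MeasurableSpace 𝒴]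
    {P : Measure Ω} [IsProbabilityMeasure P] {X : Ω → ℝ} {Y : Ω → 𝒴} (hX : Measurable X)
    (hY : Measurable Y) (hXY : X ⟂ᵢ[P] Y) {ρ : ℝ → ℝ} (hρ : Measurable ρ) (hρ0 : ∀ t, 0 ≤ ρ t)
    (hlaw : P.map X = volume.withDensity fun t => ENNReal.ofReal (ρ t))
    {I : Set ℝ} {h φ : ℝ → ℝ} {a b r m : ℝ} (hh : IsLogTest I h a b r) (hm : 0 ≤ m)
    (hφm : Measurable φ) (hφ : ∀ t, φ t * ρ t = m * h t)
    {ξ : 𝒴 → ℝ} (hξ : Measurable ξ)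
    (hint : Integrable (fun ω => Real.log |X ω - ξ (Y ω)| * φ (X ω)) P) :
    m * (a - (a + b) * P.real {ω | r ≤ |ξ (Y ω)|}) ≤
      ∫ ω, Real.log |X ω - ξ (Y ω)| * φ (X ω) ∂P := by
  have hmap := (indepFun_iff_map_prod_eq_prod_map_map hX.aemeasurable hY.aemeasurable).mp hXY
  have := Measure.isProbabilityMeasure_map (μ := P) hX.aemeasurable
  have := Measure.isProbabilityMeasure_map (μ := P) hY.aemeasurable
  let g : ℝ × 𝒴 → ℝ := fun p => Real.log |p.1 - ξ p.2| * φ p.1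
  have hg : Measurable g := by fun_prop
  have hint' : Integrable g ((P.map X).prod (P.map Y)) := by
    rw [← hmap, integrable_map_measure hg.aestronglyMeasurable (hX.prodMk hY).aemeasurable]
    exact hint
  have e1 : ∫ ω, Real.log |X ω - ξ (Y ω)| * φ (X ω) ∂P =
      ∫ y, ∫ t, g (t, y) ∂(P.map X) ∂(P.map Y) := by
    rw [← integral_prod_symm _ hint', ← hmap,
      integral_map (hX.prodMk hY).aemeasurable hg.aestronglyMeasurable]
  have e2 (y : 𝒴) : ∫ t, g (t, y) ∂(P.map X) = m * ∫ t, h t * Real.log |t - ξ y| := by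
    rw [integral_map hX.aemeasurable (by fun_prop : Measurable _).aestronglyMeasurable,
      integral_eq_of_law_withDensity hX hρ hρ0 hlaw (g := fun t => g (t, y)) (by fun_prop),
      ← integral_const_mul]
    congr 1
    ext t
    rw [mul_assoc, hφ]; ring
  let s : Set 𝒴 := {y | r ≤ |ξ y|}
  have hs : MeasurableSet s := measurableSet_le measurable_const hξ.abs
  have hs1 : Integrable (s.indicator (1 : 𝒴 → ℝ)) (P.map Y) :=
    (integrable_const (1 : ℝ)).indicator hs
  have e3 : ∫ y, m * (a - (a + b) * s.indicator 1 y) ∂(P.map Y) =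
      m * (a - (a + b) * P.real {ω | r ≤ |ξ (Y ω)|}) := by
    rw [integral_const_mul, integral_sub (integrable_const _) (hs1.const_mul _), integral_const_mul,
      integral_indicator_one hs, map_measureReal_apply hY hs]
    simp [s]
  rw [e1, ← e3]
  refine integral_mono ?_ hint'.integral_prod_right fun y => ?_
  · exact ((integrable_const _).sub (hs1.const_mul _)).const_mul _
  · beta_reduce
    rw [e2]
    refine mul_le_mul_of_nonneg_left ?_ hm
    by_cases hy : y ∈ s
    · rw [Set.indicator_of_mem hy]
      have := hh.neg_le (ξ y)
      simpa using this
    · rw [Set.indicator_of_notMem hy]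
      have := hh.le_of_abs_lt (ξ y) (not_le.mp hy)
      simpa using this

namespace IsDiagonalDisorder

variable {Ω ι 𝒵 : Type*} [MeasurableSpace Ω] [MeasurableSpace 𝒵]
  {P : Measure Ω} [IsProbabilityMeasure P] {V : ι → Ω → ℝ} {Z : Ω → 𝒵} {ρ : ℝ → ℝ} {D₀ : ℝ}

/-- Pointwise φ²ρ = φ·(m·h) ≤ m on `I`, and it vanishes off `I`. The bound is linear in `m`, like
the covariance, so the final estimate is linear too. -/
theorem variance_test_le (hD : IsDiagonalDisorder P V Z ρ D₀) (i : ι)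
    {I : Set ℝ} {h φ : ℝ → ℝ} {a b r m : ℝ} (hh : IsLogTest I h a b r) (hI : MeasurableSet I)
    (hI' : volume I ≠ ⊤) (hm : 0 ≤ m)
    (hφm : Measurable φ) (hφ1 : ∀ t, |φ t| ≤ 1) (hφ : ∀ t, φ t * ρ t = m * h t) :
    Var[fun ω => φ (V i ω); P] ≤ m * volume.real I := by
  have hVm := hD.measurable_V i
  refine (variance_le_expectation_sq (hφm.comp hVm).aestronglyMeasurable).trans ?_
  have e1 := integral_eq_of_law_withDensity hVm hD.measurable_density hD.density_nonneg
    (hD.law_V i) (hφm.pow_const 2)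
  refine e1.le.trans ?_
  have e2 : ∫ t, I.indicator (fun _ => m) t = m * volume.real I := by
    rw [integral_indicator hI, setIntegral_const, smul_eq_mul, mul_comm]
  rw [← e2]
  have hb (t : ℝ) : φ t ^ 2 * ρ t ≤ I.indicator (fun _ => m) t := by
    rw [sq, mul_assoc, hφ]
    by_cases ht : t ∈ I
    · rw [Set.indicator_of_mem ht]
      calc φ t * (m * h t) ≤ |φ t * (m * h t)| := le_abs_self _
        _ = |φ t| * (m * |h t|) := by rw [abs_mul, abs_mul, abs_of_nonneg hm]
        _ ≤ 1 * (m * 1) := by gcongr; exacts [hφ1 t, hh.abs_le_one t]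
        _ = m := by ring
    · rw [Set.indicator_of_notMem ht, hh.eq_zero t ht, mul_zero, mul_zero]
  exact integral_mono_of_nonneg (Filter.Eventually.of_forall fun t =>
    mul_nonneg (sq_nonneg _) (hD.density_nonneg t))
    ((integrable_indicator_iff hI).mpr (integrableOn_const hI')) (Filter.Eventually.of_forall hb)

variable [DecidableEq ι] {B : 𝒵 → Matrix ι ι ℝ}

/-- The determinant on `S` is independent of `V i` and φ(V_i) has mean zero, so only log|V_i − ξ_i|
contributes to the covariance. -/
theorem le_covariance_log_det (hD : IsDiagonalDisorder P V Z ρ D₀)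
    (hB : ∀ i j, Measurable fun z => B z i j) (hsymm : ∀ ω, (B (Z ω)).IsSymm)
    (hBL : ∀ i j, LogSqIntegrable P fun ω => B (Z ω) i j) (hV : ∀ i, LogSqIntegrable P (V i))
    {I : Set ℝ} {h φ : ℝ → ℝ} {a b r m : ℝ} (hh : IsLogTest I h a b r) (hm : 0 ≤ m)
    (hφm : Measurable φ) (hφ1 : ∀ t, |φ t| ≤ 1) (hφ : ∀ t, φ t * ρ t = m * h t)
    {S : Finset ι} {i : ι} (hi : i ∉ S) :
    m * (a - (a + b) * P.real {ω | r ≤ |selfEnergy (B (Z ω)) S i (fun j => V j ω)|}) ≤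
      cov[fun ω => Real.log
        |(principal (Matrix.diagonal (fun j => V j ω) + B (Z ω)) (insert i S)).det|,
        fun ω => φ (V i ω); P] := by
  have hVm := hD.measurable_V i
  have hφV : MemLp (fun ω => φ (V i ω)) 2 P :=
    .of_bound (hφm.comp hVm).aestronglyMeasurable 1 (Filter.Eventually.of_forall fun ω => hφ1 _)
  have hφ0 : ∫ ω, φ (V i ω) ∂P = 0 := by
    rw [integral_eq_of_law_withDensity hVm hD.measurable_density hD.density_nonneg (hD.law_V i) hφm]
    simp only [hφ]
    rw [integral_const_mul, hh.integral_eq_zero, mul_zero]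
  have hG := hD.memLp_log_det hB hsymm hBL hV S
  have hL := hD.memLp_log_sub_selfEnergy hB hsymm hBL hV hi
  let Y : Ω → (ι → ℝ) × 𝒵 := fun ω => (Function.update (fun j => V j ω) i 0, Z ω)
  have hY : Measurable Y := (measurable_update_left.comp hD.measurable_pi).prodMk hD.measurable_Z
  have hind : V i ⟂ᵢ[P] Y := hD.indepFun_update i
  have hGφ : ∫ ω, Real.log |(principal (Matrix.diagonal (fun j => V j ω) + B (Z ω)) S).det| *
      φ (V i ω) ∂P = 0 := by
    let f : (ι → ℝ) × 𝒵 → ℝ := fun p =>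
      Real.log |(principal (Matrix.diagonal p.1 + B p.2) S).det|
    have hf : Measurable f := (measurable_det_principal hB S).abs.log
    have hfY (ω : Ω) : Real.log |(principal (Matrix.diagonal (fun j => V j ω) + B (Z ω)) S).det| =
        f (Y ω) := by
      simp only [f, Y, principal_diagonal_update_add _ _ hi]
    simp only [hfY]
    have := (hind.symm.comp hf hφm).integral_mul_eq_mul_integral
      (hf.comp hY).aestronglyMeasurable (hφm.comp hVm).aestronglyMeasurable
    exact this.trans (mul_eq_zero_of_right _ hφ0)
  let ξ : (ι → ℝ) × 𝒵 → ℝ := fun p => selfEnergy (B p.2) S i p.1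
  have hξY (ω : Ω) : selfEnergy (B (Z ω)) S i (fun j => V j ω) = ξ (Y ω) := by
    simp only [ξ, Y, selfEnergy_update _ hi]
  have hFae : (fun ω => Real.log
      |(principal (Matrix.diagonal (fun j => V j ω) + B (Z ω)) (insert i S)).det|) =ᵐ[P]
      fun ω => Real.log |(principal (Matrix.diagonal (fun j => V j ω) + B (Z ω)) S).det| +
        Real.log |V i ω - selfEnergy (B (Z ω)) S i (fun j => V j ω)| := by
    filter_upwards [hD.ae_det_ne_zero hB S, hD.ae_sub_selfEnergy_ne_zero hB hi] with ω h1 h2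
    rw [det_principal_insert _ hi h1, abs_mul, Real.log_mul (abs_ne_zero.mpr h1)]
    · simp [selfEnergy]
    · simpa [selfEnergy] using h2
  rw [covariance_eq_sub (hD.memLp_log_det hB hsymm hBL hV _) hφV, hφ0, mul_zero, sub_zero]
  have hLφ : Integrable (fun ω =>
      Real.log |V i ω - selfEnergy (B (Z ω)) S i (fun j => V j ω)| * φ (V i ω)) P :=
    hL.integrable_mul hφV
  have hGφ' : Integrable (fun ω =>
      Real.log |(principal (Matrix.diagonal (fun j => V j ω) + B (Z ω)) S).det| * φ (V i ω)) P :=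
    hG.integrable_mul hφV
  have hsplit : ∫ ω, Real.log
      |(principal (Matrix.diagonal (fun j => V j ω) + B (Z ω)) (insert i S)).det| * φ (V i ω) ∂P =
      ∫ ω, Real.log |V i ω - selfEnergy (B (Z ω)) S i (fun j => V j ω)| * φ (V i ω) ∂P := by
    rw [← zero_add (∫ ω, Real.log |V i ω - _| * φ (V i ω) ∂P), ← hGφ,
      ← integral_add hGφ' hLφ]
    refine integral_congr_ae ?_
    filter_upwards [hFae] with ω hω
    rw [hω, add_mul]
  refine le_of_le_of_eq ?_ hsplit.symm
  simp only [hξY]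
  refine le_integral_log_mul hVm hY hind hD.measurable_density hD.density_nonneg (hD.law_V i) hh hm
    hφm hφ (measurable_selfEnergy hB S i) ?_
  simpa only [hξY] using hLφ

theorem le_variance_log_det (hD : IsDiagonalDisorder P V Z ρ D₀)
    (hB : ∀ i j, Measurable fun z => B z i j) (hsymm : ∀ ω, (B (Z ω)).IsSymm)
    (hBL : ∀ i j, LogSqIntegrable P fun ω => B (Z ω) i j) (hV : ∀ i, LogSqIntegrable P (V i))
    {I : Set ℝ} {h : ℝ → ℝ} {a b r : ℝ} (hh : IsLogTest I h a b r) (hI : MeasurableSet I)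
    (hI' : volume I ≠ ⊤) (hab : 0 ≤ a + b) {p c : ℝ} (hc : 0 ≤ c) (S : Finset ι)
    (hp : ∀ i ∈ S, P.real {ω | r ≤ |selfEnergy (B (Z ω)) (S.erase i) i (fun j => V j ω)|} ≤ p) :
    S.card * (2 * c * (sInf (ρ '' I) * (a - (a + b) * p)) -
      c ^ 2 * (sInf (ρ '' I) * volume.real I)) ≤
      Var[fun ω => Real.log |(principal (Matrix.diagonal (fun j => V j ω) + B (Z ω)) S).det|; P] := by
  set m := sInf (ρ '' I) with hm
  have hm0 : 0 ≤ m := Real.sInf_nonneg (by rintro _ ⟨t, -, rfl⟩; exact hD.density_nonneg t)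
  rcases hm0.eq_or_lt with h0 | h0
  · rw [← h0]
    simp [variance_nonneg]
  have hmρ (t : ℝ) (ht : t ∈ I) : m ≤ ρ t :=
    csInf_le ⟨0, by rintro _ ⟨t, -, rfl⟩; exact hD.density_nonneg t⟩ ⟨t, ht, rfl⟩
  -- Dividing by `ρ` replaces the law of `V i` by Lebesgue measure; `ρ ≥ m` on `I` keeps |φ| ≤ 1.
  -- The case `m = 0`, excluded above, is trivial.
  let φ : ℝ → ℝ := fun t => m * h t / ρ t
  have hφm : Measurable φ := (hh.measurable.const_mul m).div hD.measurable_density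
  have hφ (t : ℝ) : φ t * ρ t = m * h t := by
    by_cases ht : t ∈ I
    · exact div_mul_cancel₀ _ (h0.trans_le (hmρ t ht)).ne'
    · simp [φ, hh.eq_zero t ht]
  have hφ1 (t : ℝ) : |φ t| ≤ 1 := by
    by_cases ht : t ∈ I
    · have hρ := h0.trans_le (hmρ t ht)
      rw [abs_div, abs_mul, abs_of_pos h0, abs_of_pos hρ, div_le_one hρ]
      nlinarith [hh.abs_le_one t, hmρ t ht]
    · simp [φ, hh.eq_zero t ht]
  refine le_variance_of_le_covariance (hD.memLp_log_det hB hsymm hBL hV S)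
    (X := fun i ω => φ (V i ω)) (fun i _ => ?_) (fun i _ j _ hij => ?_) hc (fun i hi => ?_)
    (fun i _ => hD.variance_test_le i hh hI hI' hm0 hφm hφ1 hφ)
  · exact .of_bound (hφm.comp (hD.measurable_V i)).aestronglyMeasurable 1
      (Filter.Eventually.of_forall fun ω => hφ1 _)
  · exact (hD.indep_V.indepFun hij).comp hφm hφm
  · have := hD.le_covariance_log_det hB hsymm hBL hV hh hm0 hφm hφ1 hφ (S.notMem_erase i)
    rw [Finset.insert_erase hi] at this
    refine le_trans ?_ this
    gcongr
    exact hp i hi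

end IsDiagonalDisorder

/-! ### The strip operator and the choice of constants -/

/-- The part of `H - E` that does not depend on the potentials, as a function of the entries of the
matrices `U_n`. -/
def stripOffset {W : ℕ} (E : ℝ) (z : ℤ × Fin W × Fin W → ℝ) :
    Matrix (ℤ × Fin W) (ℤ × Fin W) ℝ :=
  Matrix.of fun i j =>
    if i.1 = j.1 then -z (i.1, i.2, j.2) - (if i.2 = j.2 then E else 0)
    else if |i.1 - j.1| = 1 ∧ i.2 = j.2 then -1 else 0

theorem dirichletDet_eq {W : ℕ} (V : ℤ × Fin W → ℝ) (U : ℤ → Matrix (Fin W) (Fin W) ℝ)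
    (Λ : Finset (ℤ × Fin W)) (E : ℝ) :
    dirichletDet V U Λ E = (principal
      (Matrix.diagonal V + stripOffset E fun k => U k.1 k.2.1 k.2.2) Λ).det := by
  rw [dirichletDet]
  congr 1
  ext ⟨⟨n, x⟩, hi⟩ ⟨⟨m, y⟩, hj⟩
  simp only [principal, Matrix.sub_apply, Matrix.smul_apply, Matrix.submatrix_apply,
    Matrix.add_apply, stripHRestr_apply, Matrix.one_apply, Matrix.diagonal_apply, stripOffset,
    Matrix.of_apply, Subtype.mk.injEq, Prod.mk.injEq, smul_eq_mul]
  by_cases h1 : n = m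
  · by_cases h2 : x = y
    · simp [h1, h2]; ring
    · simp [h1, h2]
  · simp [h1]

theorem abs_entry_le_norm_toEuclideanCLM {W : ℕ} (A : Matrix (Fin W) (Fin W) ℝ) (x y : Fin W) :
    |A x y| ≤ ‖Matrix.toEuclideanCLM (𝕜 := ℝ) A‖ := by
  have h1 : Matrix.toEuclideanCLM (𝕜 := ℝ) A (EuclideanSpace.single y 1) x = A x y := by
    simp [Matrix.ofLp_toEuclideanCLM]
  calc |A x y| = ‖Matrix.toEuclideanCLM (𝕜 := ℝ) A (EuclideanSpace.single y 1) x‖ := by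
        rw [h1, Real.norm_eq_abs]
    _ ≤ ‖Matrix.toEuclideanCLM (𝕜 := ℝ) A (EuclideanSpace.single y 1)‖ := PiLp.norm_apply_le _ _
    _ ≤ ‖Matrix.toEuclideanCLM (𝕜 := ℝ) A‖ * ‖EuclideanSpace.single y (1 : ℝ)‖ :=
        ContinuousLinearMap.le_opNorm _ _
    _ = _ := by simp

/-- The sites that may be coupled to a given site of the strip. -/
def stripNeighbors {W : ℕ} (d : ℕ) (i : ℤ × Fin W) : Finset (ℤ × Fin W) :=
  {(i.1 - 1, i.2), (i.1 + 1, i.2)} ∪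
    ({i.1} ×ˢ Finset.univ.filter fun y : Fin W => |(i.2 : ℤ) - (y : ℤ)| ≤ d)

/-- At most 2d+1 sites in the same layer (the site itself included) and two in adjacent layers. The
absence of `W` makes the constants uniform in the width. -/
theorem card_stripNeighbors_le {W : ℕ} (d : ℕ) (i : ℤ × Fin W) :
    (stripNeighbors d i).card ≤ 2 * d + 3 := by
  have h : (Finset.univ.filter fun y : Fin W => |(i.2 : ℤ) - (y : ℤ)| ≤ d).card ≤ 2 * d + 1 := by
    refine (Finset.card_le_card_of_injOn (t := Finset.Icc ((i.2 : ℤ) - d) ((i.2 : ℤ) + d))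
      (fun y : Fin W => ((y : ℕ) : ℤ)) (fun y hy => ?_) ?_).trans ?_
    · simp only [Finset.coe_filter, Finset.mem_univ, true_and, Set.mem_ofPred_eq, abs_le] at hy
      simp only [Finset.coe_Icc, Set.mem_Icc]
      omega
    · intro a _ b _ hab
      simpa [Fin.ext_iff] using hab
    · rw [Int.card_Icc]; omega
  have h2 := Finset.card_le_two (a := (i.1 - 1, i.2)) (b := (i.1 + 1, i.2))
  refine (Finset.card_union_le _ _).trans ?_
  rw [Finset.card_product, Finset.card_singleton]
  omega

namespace IsRandomStrip

variable {Ω : Type*} [MeasurableSpace Ω] {P : Measure Ω} {W : ℕ}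
  {V : ℤ × Fin W → Ω → ℝ} {U : ℤ → Ω → Matrix (Fin W) (Fin W) ℝ} {ρ : ℝ → ℝ} {D₀ D₁ : ℝ} {d : ℕ}

theorem isDiagonalDisorder (h : IsRandomStrip P V U ρ D₀ D₁ d) : IsDiagonalDisorder P V
    (fun ω (k : ℤ × Fin W × Fin W) => U k.1 ω k.2.1 k.2.2) ρ D₀ where
  measurable_V := h.measurable_V
  measurable_Z := measurable_pi_iff.mpr fun _ => h.measurable_U _ _ _
  measurable_density := h.measurable_density
  density_nonneg := h.density_nonneg
  density_le := h.density_le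
  law_V := h.law_V
  indep_V := h.indep_V
  indep_V_Z := h.indep_V_U

theorem measurable_stripOffset (E : ℝ) (i j : ℤ × Fin W) :
    Measurable fun z : ℤ × Fin W × Fin W → ℝ => stripOffset E z i j := by
  simp only [stripOffset, Matrix.of_apply]
  split_ifs <;> fun_prop

theorem isSymm_stripOffset (h : IsRandomStrip P V U ρ D₀ D₁ d) (E : ℝ) (ω : Ω) :
    (stripOffset E fun k : ℤ × Fin W × Fin W => U k.1 ω k.2.1 k.2.2).IsSymm := by
  ext i j
  simp only [Matrix.transpose_apply, stripOffset, Matrix.of_apply]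
  rw [abs_sub_comm j.1 i.1]
  simp only [eq_comm (a := j.1), eq_comm (a := j.2)]
  split_ifs with h1 h2 <;> simp [h1, (h.symm_U j.1 ω).apply i.2 j.2]

theorem stripOffset_eq_zero (h : IsRandomStrip P V U ρ D₀ D₁ d) (E : ℝ) (ω : Ω)
    {i j : ℤ × Fin W} (hji : j ≠ i) (hj : j ∉ stripNeighbors d i) :
    stripOffset E (fun k : ℤ × Fin W × Fin W => U k.1 ω k.2.1 k.2.2) i j = 0 := by
  obtain ⟨n, x⟩ := i
  obtain ⟨m, y⟩ := j
  simp only [stripNeighbors, Finset.mem_union, Finset.mem_insert, Finset.mem_singleton,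
    Finset.mem_product, Finset.mem_filter, Finset.mem_univ, true_and, Prod.mk.injEq, not_or,
    not_and, not_le] at hj
  simp only [stripOffset, Matrix.of_apply]
  rcases eq_or_ne n m with rfl | hnm
  · have hxy : x ≠ y := fun hxy => hji (by rw [hxy])
    simp [hxy, h.band_U n ω x y (hj.2 rfl)]
  · rw [if_neg hnm, if_neg]
    rintro ⟨h1, h2⟩
    rcases (abs_eq one_pos.le).mp h1 with h1 | h1
    · exact hj.1.1 (by omega) h2.symm
    · exact hj.1.2 (by omega) h2.symm

variable [IsProbabilityMeasure P]

theorem logSqIntegrable_V (h : IsRandomStrip P V U ρ D₀ D₁ d) (i : ℤ × Fin W) :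
    LogSqIntegrable P (V i) :=
  .of_tail (h.measurable_V i) (h.tail_V i)

theorem logSqIntegrable_stripOffset (h : IsRandomStrip P V U ρ D₀ D₁ d) (E : ℝ)
    (i j : ℤ × Fin W) : LogSqIntegrable P fun ω =>
      stripOffset E (fun k : ℤ × Fin W × Fin W => U k.1 ω k.2.1 k.2.2) i j := by
  have hU : LogSqIntegrable P fun ω => U i.1 ω i.2 j.2 :=
    .of_tail (h.measurable_U _ _ _) fun T hT => (measureReal_mono fun ω hω =>
      le_trans hω (abs_entry_le_norm_toEuclideanCLM _ _ _)).trans (h.tail_U i.1 T hT)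
  simp only [stripOffset, Matrix.of_apply]
  split_ifs
  · simpa only [sub_eq_add_neg] using hU.neg.add (.const (-E))
  · simpa only [sub_eq_add_neg] using hU.neg.add (.const (-0))
  · exact .const _
  · exact .const _

/-- The operator norm of one `U n` dominates the whole row, so no union bound over entries is
needed; 1 + |E| absorbs the hopping terms and the energy. -/
theorem measure_exists_le_abs_stripOffset (h : IsRandomStrip P V U ρ D₀ D₁ d) (E : ℝ)
    (i : ℤ × Fin W) {T : ℝ} (hT : 1 ≤ T) :
    P.real {ω | ∃ j, T + (1 + |E|) ≤
      |stripOffset E (fun k : ℤ × Fin W × Fin W => U k.1 ω k.2.1 k.2.2) i j|} ≤ D₁ / T := by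
  refine (measureReal_mono ?_).trans (h.tail_U i.1 T hT)
  rintro ω ⟨j, hj⟩
  have hE := abs_nonneg E
  simp only [stripOffset, Matrix.of_apply] at hj
  split_ifs at hj with h1 h2
  · refine le_trans ?_ (abs_entry_le_norm_toEuclideanCLM (U i.1 ω) i.2 j.2)
    have := abs_sub (-U i.1 ω i.2 j.2) E
    rw [abs_neg] at this
    linarith
  · refine le_trans ?_ (abs_entry_le_norm_toEuclideanCLM (U i.1 ω) i.2 j.2)
    rw [sub_zero, abs_neg] at hj
    linarith
  · rw [abs_neg, abs_one] at hj; linarith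
  · rw [abs_zero] at hj; linarith

end IsRandomStrip

/-- A threshold that the self-energies exceed with probability at most `δ`. -/
def selfEnergyThreshold (δ D₀ D₁ e : ℝ) (d : ℕ) : ℝ :=
  -- `R` fails to bound the row, and the last factor the resolvent entries between neighbours, with
  -- probability at most δ/2 each. Absolute values keep the threshold positive for all parameters.
  let R := (1 + 2 * |D₁| / δ) + (1 + |e|)
  R + (2 * d + 3 : ℝ) ^ 2 * (R ^ 2 * (1 + 16 * (2 * d + 3 : ℝ) ^ 2 * |D₀| / δ))

theorem selfEnergyThreshold_pos {δ : ℝ} (hδ : 0 < δ) (D₀ D₁ e : ℝ) (d : ℕ) :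
    0 < selfEnergyThreshold δ D₀ D₁ e d := by
  simp only [selfEnergyThreshold]
  positivity

theorem IsRandomStrip.measure_threshold_le_abs_selfEnergy {Ω : Type*} [MeasurableSpace Ω]
    {P : Measure Ω} [IsProbabilityMeasure P] {W : ℕ} {V : ℤ × Fin W → Ω → ℝ}
    {U : ℤ → Ω → Matrix (Fin W) (Fin W) ℝ} {ρ : ℝ → ℝ} {D₀ D₁ : ℝ} {d : ℕ}
    (h : IsRandomStrip P V U ρ D₀ D₁ d) (E : ℝ) {δ : ℝ} (hδ : 0 < δ) {S : Finset (ℤ × Fin W)}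
    {i : ℤ × Fin W} (hi : i ∉ S) :
    P.real {ω | selfEnergyThreshold δ D₀ D₁ |E| d ≤ |selfEnergy
      (stripOffset E fun k : ℤ × Fin W × Fin W => U k.1 ω k.2.1 k.2.2) S i
        (fun j => V j ω)|} ≤ δ := by
  have hD₀ : 0 ≤ D₀ := (h.density_nonneg 0).trans (h.density_le 0)
  set T₁ : ℝ := 1 + 2 * |D₁| / δ with hT₁
  set K : ℝ := (2 * d + 3 : ℝ) with hK
  set T₂ : ℝ := 1 + 16 * K ^ 2 * |D₀| / δ with hT₂
  have hK0 : 0 < K := by positivity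
  have h1 : 1 ≤ T₁ := by rw [hT₁]; linarith [show 0 ≤ 2 * |D₁| / δ by positivity]
  have h2 : 0 < T₂ := by positivity
  have hN : ((stripNeighbors d i).card : ℝ) ≤ K := by
    rw [hK]
    exact_mod_cast card_stripNeighbors_le d i
  have key := h.isDiagonalDisorder.measure_le_abs_selfEnergy
    (fun i j => measurable_stripOffset E i j) (h.isSymm_stripOffset E)
    (fun ω j hji hj => h.stripOffset_eq_zero E ω hji hj) (by positivity)
    (h.measure_exists_le_abs_stripOffset E i h1) h2 hi
  have e1 : D₁ / T₁ ≤ δ / 2 := by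
    rw [div_le_iff₀ (by positivity), hT₁]
    have : δ / 2 * (1 + 2 * |D₁| / δ) = δ / 2 + |D₁| := by field_simp
    linarith [le_abs_self D₁]
  have e2 : K ^ 2 * (8 * D₀ / T₂) ≤ δ / 2 := by
    rw [← mul_div_assoc, div_le_iff₀ h2, hT₂]
    have : δ / 2 * (1 + 16 * K ^ 2 * |D₀| / δ) = δ / 2 + 8 * K ^ 2 * |D₀| := by field_simp; ring
    rw [this, abs_of_nonneg hD₀]
    linarith
  refine (measureReal_mono fun ω hω => ?_).trans (key.trans ?_)
  · have hω' : selfEnergyThreshold δ D₀ D₁ |E| d ≤ |selfEnergy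
      (stripOffset E fun k : ℤ × Fin W × Fin W => U k.1 ω k.2.1 k.2.2) S i
        (fun j => V j ω)| := hω
    refine le_trans ?_ hω'
    simp only [selfEnergyThreshold, abs_abs]
    rw [← hT₁, ← hK, ← hT₂]
    gcongr
  · calc _ ≤ D₁ / T₁ + K ^ 2 * (8 * D₀ / T₂) := by gcongr
      _ ≤ δ / 2 + δ / 2 := add_le_add e1 e2
      _ = δ := by ring

end

theorem theorem1p2 :
    ∃ (c C₁ : ℝ) (C₀ : ℝ → ℝ → ℝ → ℕ → ℝ), 0 < c ∧ 1 < C₁ ∧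
      (∀ (D₀ D₁ e : ℝ) (d : ℕ), 0 < C₀ D₀ D₁ e d) ∧
      ∀ (Ω : Type*) [MeasurableSpace Ω] (P : Measure Ω) [IsProbabilityMeasure P]
        (W : ℕ) (V : ℤ × Fin W → Ω → ℝ) (U : ℤ → Ω → Matrix (Fin W) (Fin W) ℝ)
        (ρ : ℝ → ℝ) (D₀ D₁ : ℝ) (d : ℕ),
        1 ≤ W → 1 ≤ d → IsRandomStrip P V U ρ D₀ D₁ d →
        ∀ (E : ℝ) (Λ : Finset (ℤ × Fin W)),
          MemLp (fun ω => Real.log |dirichletDet (fun i => V i ω) (fun n => U n ω) Λ E|) 2 P ∧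
          ∀ (M₀ : ℝ), C₀ D₀ D₁ |E| d ≤ M₀ →
            ∀ I : Set ℝ,
              (I = Set.Icc M₀ (C₁ * M₀) ∨ I = Set.Icc (-(C₁ * M₀)) (-M₀)) →
              c * (Λ.card : ℝ) * volume.real I * sInf (ρ '' I) ≤
                variance (fun ω =>
                  Real.log |dirichletDet (fun i => V i ω) (fun n => U n ω) Λ E|) P := by
  obtain ⟨ε, hε, C, hC, htest⟩ := exists_isLogTest
  -- Small enough that the loss (M/4 + CM)δ is at most M/8, half of the main term.
  set δ : ℝ := 1 / (8 * (C + 1)) with hδ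
  have hδ0 : 0 < δ := by positivity
  -- The ratio 3 is that of the test interval [M, 3M]; dividing by `ε` puts the threshold below εM.
  refine ⟨1 / 256, 3, fun D₀ D₁ e d => selfEnergyThreshold δ D₀ D₁ e d / ε, by norm_num,
    by norm_num, fun D₀ D₁ e d => div_pos (selfEnergyThreshold_pos hδ0 _ _ _ _) hε, ?_⟩
  intro Ω _ P _ W V U ρ D₀ D₁ d _ _ h E Λ
  have hD := h.isDiagonalDisorder
  have hB := IsRandomStrip.measurable_stripOffset (W := W) E
  simp only [dirichletDet_eq]
  refine ⟨hD.memLp_log_det hB (h.isSymm_stripOffset E) (h.logSqIntegrable_stripOffset E)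
    h.logSqIntegrable_V Λ, fun M hM I hI => ?_⟩
  have hM0 : 0 < M := (div_pos (selfEnergyThreshold_pos hδ0 D₀ D₁ |E| d) hε).trans_le hM
  have hMε : selfEnergyThreshold δ D₀ D₁ |E| d ≤ ε * M := by
    rwa [div_le_iff₀ hε, mul_comm] at hM
  have hlog : ∃ g, IsLogTest I g (M / 4) (C * M) (ε * M) := by
    obtain ⟨g, hg⟩ := htest M hM0
    rcases hI with rfl | rfl
    · exact ⟨g, hg⟩
    · exact ⟨_, hg.comp_neg fun t ht => ⟨by linarith [ht.2], by linarith [ht.1]⟩⟩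
  obtain ⟨g, hg⟩ := hlog
  have hImeas : MeasurableSet I := by rcases hI with rfl | rfl <;> exact measurableSet_Icc
  have hIvol : volume I = ENNReal.ofReal (2 * M) := by
    rcases hI with rfl | rfl <;> rw [Real.volume_Icc] <;> congr 1 <;> ring
  have hIreal : volume.real I = 2 * M := by
    rw [measureReal_def, hIvol, ENNReal.toReal_ofReal (by positivity)]
  have hp (i : ℤ × Fin W) (_ : i ∈ Λ) : P.real {ω | ε * M ≤ |selfEnergy
      (stripOffset E fun k : ℤ × Fin W × Fin W => U k.1 ω k.2.1 k.2.2) (Λ.erase i) i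
        (fun j => V j ω)|} ≤ δ :=
    (measureReal_mono fun ω hω => hMε.trans hω).trans
      (h.measure_threshold_le_abs_selfEnergy E hδ0 (Λ.notMem_erase i))
  -- The value 1/16 maximizes 2c·(M/8) − c²·(2M); the maximum M/128 equals |I|/256.
  refine le_trans ?_ (hD.le_variance_log_det hB (h.isSymm_stripOffset E)
    (h.logSqIntegrable_stripOffset E) h.logSqIntegrable_V hg hImeas (hIvol ▸ ENNReal.ofReal_ne_top)
    (by positivity) (c := 1 / 16) (by norm_num) Λ hp)
  have hm : 0 ≤ sInf (ρ '' I) :=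
    Real.sInf_nonneg (by rintro _ ⟨t, -, rfl⟩; exact h.density_nonneg t)
  have hq : M / 8 ≤ M / 4 - (M / 4 + C * M) * δ := by
    have h1 : (C + 1) * δ = 1 / 8 := by rw [hδ]; field_simp
    have h2 : (M / 4 + C * M) * δ ≤ M * ((C + 1) * δ) := by nlinarith [mul_pos hM0 hδ0]
    rw [h1] at h2
    linarith
  have hmq := mul_le_mul_of_nonneg_left hq hm
  rw [hIreal, mul_comm (1 / 256 : ℝ), mul_assoc, mul_assoc]
  refine mul_le_mul_of_nonneg_left ?_ (Nat.cast_nonneg _)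
  linarith
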